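/- **Attractor tree formula (general version).** Let $S=\mathbb N^r\setminus\{0\}$, and let $\mathcal R=\bigoplus_{\gamma\in\mathbb N^r}\mathcal R_\gamma$ be a graded associative unital $\mathbb Q$-algebra. Let $\langle-,-\rangle$ be an integer-valued skew-symmetric bilinear form on $\mathbb Z^r$ such that, for $\gamma,\gamma'\in S$, $\langle\gamma,\gamma'\rangle=0$ implies $[\mathcal R_\gamma,\mathcal R_{\gamma'}]=0$. Fix $A:S\to\mathcal R$ with $A(\gamma)\in\mathcal R_\gamma$ for all $\gamma\in S$. *Action.* For a function $F:\bigsqcup_{n\ge1}S^n\to\mathbb Q$ (a collection) and $H:S\to\mathcal R$, put $(F*H)(\gamma)=\sum_{n\ge1}\sum_{\alpha\in S^n,\ \alpha_1+\dots+\alpha_n=\gamma}F(\alpha)\,H(\alpha_1)\cdots H(\alpha_n)$, which is a finite sum. *DT invariants.* A central charge is $Z=-\theta+\mathbf i\rho$ with $\theta,\rho\in\mathbb R^r$ and $\rho_k>0$ for all $k$. Its slope is $\mu_Z(a)=\frac{\sum_k\theta_ka_k}{\sum_k\rho_ka_k}$ for $a\in S$. Write $a<_Zb$ if $\mu_Z(a)<\mu_Z(b)$,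 and $a\sim_Zb$ if $\mu_Z(a)=\mu_Z(b)$. Define $A_Z:S\to\mathcal R$ recursively by $$A(\gamma)=\sum_{\alpha_1+\dots+\alpha_n=\gamma,\ \alpha_1>_Z\dots>_Z\alpha_n}A_Z(\alpha_1)\cdots A_Z(\alpha_n),\qquad\gamma\in S.$$ The rational DT invariants are $\bar A_Z=\mathbf{log}_Z*A_Z$, where, for $\alpha\in S^n$, $\mathbf{log}_Z(\alpha)=\frac{(-1)^{n-1}}n$ if $\alpha_1\sim_Z\dots\sim_Z\alpha_n$, and $\mathbf{log}_Z(\alpha)=0$ otherwise. For $\theta\in\mathbb R^r$, the index $\theta$ (as in $\bar A_\theta$ or $\sim_\theta$) refers to the central charge with this $\theta$ and $\rho=(1,\dots,1)$. Call $\theta$ generic if, for $a,b\in S$, $a\sim_\theta b$ implies $ma=nb$ for some integers $m,n\ge1$. *Attractor invariants.* For $\gamma\in S$, $\bar A_*(\gamma)=\bar A_{\theta'}(\gamma)$, where $\theta'$ is a generic perturbation of $\theta=\langle-,\gamma\rangle$, that is, any generic element of a sufficiently small neighbourhood (depending on $\gamma$) of the vector in $\mathbb R^r$ with coordinates $\theta_k=\langle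 e_k,\gamma\rangle$. *Tree collections.* Let $t\in\mathbb Q$. For $\alpha\in S^n$ and $1\le k<n$ let $\alpha_{\le k}=\alpha_1+\dots+\alpha_k$ and $\alpha_{>k}=\alpha_{k+1}+\dots+\alpha_n$. Put $$g_{Z,t}(\alpha)=t^{n_-}(t-1)^{n_+}\,\frac{t^{n_0+1}-(t-1)^{n_0+1}}{n_0+1},$$ where $n_+,n_-,n_0$ are the numbers of $1\le k<n$ with $\alpha_{\le k}>_Z\alpha_{>k}$, $\alpha_{\le k}<_Z\alpha_{>k}$, $\alpha_{\le k}\sim_Z\alpha_{>k}$ respectively (with $0^0=1$). Define $g_{*,t}(\alpha)$ by the same expression, where now $n_+,n_-,n_0$ are the numbers of $1\le k<n$ with $\langle\alpha_{\le k},\alpha_{>k}\rangle$ positive, negative, zero respectively. Put $F_{Z,t}(\alpha)=1$ for $\alpha\in S^1$, and, for $\alpha\in S^n$ with $n\ge2$, $$F_{Z,t}(\alpha)=\sum_T(-1)^{|V(T)|-1}\bigl(g_{Z,t}(\alpha|_{\mathrm{ch}\,v_0})-g_{*,t}(\alpha|_{\mathrm{ch}\,v_0})\bigr)\prod_{v\in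 V(T)\setminus\{v_0\}}g_{*,t}(\alpha|_{\mathrm{ch}\,v}).$$ The sum runs over plane rooted trees $T$ with leaves $1,\dots,n$ (in this order) all of whose internal vertices have at least two children. Here $V(T)$ is the set of internal vertices, $v_0$ is the root, and $\alpha|_{\mathrm{ch}\,v}=(\alpha_u)_u$ is the tuple indexed by the children $u$ of $v$ in their order, with $\alpha_u$ the sum of the $\alpha_i$ over the leaves $i$ below or equal to $u$. **Theorem.** The attractor invariants $\bar A_*(\gamma)$ are well defined, i.e. for every $\gamma\in S$ the value $\bar A_{\theta'}(\gamma)$ is the same for all generic $\theta'$ sufficiently close to $\langle-,\gamma\rangle$. For every central charge $Z$ and every $t\in\mathbb Q$, $\bar A_Z=F_{Z,t}*\bar A_*$, i.e. for every $\gamma\in S$ $$\bar A_Z(\gamma)=\sum_{n\ge1}\ \sum_{\alpha\in S^n,\ \alpha_1+\dots+\alpha_n=\gamma}F_{Z,t}(\alpha)\,\bar A_*(\alpha_1)\cdots\bar A_*(\alpha_n).$$ -/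

import Mathlib

open Filter Topology

/-- Vectors in `ℕ^r`. The semigroup `S = ℕ^r \ {0}` is the set of nonzero ones. -/
abbrev DimVec (r : ℕ) : Type := Fin r → ℕ

/-- The inclusion `ℕ^r ⊆ Γ = ℤ^r`. -/
def DimVec.toInt {r : ℕ} (a : DimVec r) : Fin r → ℤ := fun k => (a k : ℤ)

/-- Collections with values in `ℚ`: functions of a tuple `α = (α₁, …, αₙ)`. Only their values at
nonempty tuples of nonzero vectors are ever used. -/
abbrev Coll (r : ℕ) : Type := List (DimVec r) → ℚ

/-! ### Tuples with a given sum, and the action of collections on 1-collections -/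

theorem finite_lists_of_mem {X : Type*} {s : Set X} (hs : s.Finite) (n : ℕ) :
    {l : List X | l.length ≤ n ∧ ∀ x ∈ l, x ∈ s}.Finite := by
  have : Finite s := hs
  refine ((List.finite_length_le s n).image (List.map Subtype.val)).subset ?_
  rintro l ⟨h1, h2⟩
  lift l to List s using h2
  exact ⟨l, by simpa using h1, rfl⟩

theorem DimVec.length_le_of_sum_eq {r : ℕ} :
    ∀ α : List (DimVec r), (0 : DimVec r) ∉ α → α.length ≤ ∑ i, α.sum i
  | [], _ => by simp
  | a :: α, h => by
    have h1 := DimVec.length_le_of_sum_eq α (fun h' => h (List.mem_cons_of_mem _ h'))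
    have ha : a ≠ 0 := fun h' => h (by simp [h'])
    obtain ⟨i, hi⟩ := Function.ne_iff.1 ha
    have h2 : a i ≤ ∑ i, a i := Finset.single_le_sum (fun _ _ => Nat.zero_le _) (Finset.mem_univ i)
    simp only [List.length_cons, List.sum_cons, Pi.add_apply, Finset.sum_add_distrib]
    simp only [Pi.zero_apply] at hi
    omega

theorem DimVec.finite_tuples {r : ℕ} (γ : DimVec r) :
    {α : List (DimVec r) | (0 : DimVec r) ∉ α ∧ α.sum = γ}.Finite := by
  refine (finite_lists_of_mem (Set.finite_Iic γ) (∑ i, γ i)).subset ?_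
  rintro α ⟨h0, rfl⟩
  exact ⟨DimVec.length_le_of_sum_eq α h0, fun x hx => List.le_sum_of_mem hx⟩

/-- All tuples `α` of elements of `S`, of any length, with `α₁ + ⋯ + αₙ = γ`. -/
noncomputable def tuples {r : ℕ} (γ : DimVec r) : Finset (List (DimVec r)) :=
  (DimVec.finite_tuples γ).toFinset

theorem mem_tuples {r : ℕ} {γ : DimVec r} {α : List (DimVec r)} :
    α ∈ tuples γ ↔ (0 : DimVec r) ∉ α ∧ α.sum = γ := by
  simp [tuples]

/-- The action of a collection on a 1-collection,
`(F * H)(γ) = ∑_{α₁ + ⋯ + αₙ = γ} F(α) H(α₁) ⋯ H(αₙ)`. -/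
noncomputable def Coll.act {r : ℕ} {R : Type*} [Ring R] [Algebra ℚ R]
    (F : Coll r) (H : DimVec r → R) (γ : DimVec r) : R :=
  ∑ α ∈ tuples γ, F α • (α.map H).prod

/-! ### Central charges -/

/-- A central charge `Z = -θ + iρ` on `ℤ^r`, with `ρ_k > 0` for all `k`. -/
structure CentralCharge (r : ℕ) where
  θ : Fin r → ℝ
  ρ : Fin r → ℝ
  ρ_pos : ∀ k, 0 < ρ k

namespace CentralCharge

variable {r : ℕ}

/-- The central charge with the given `θ` and with `ρ = (1, …, 1)`. -/
def ofTheta (θ : Fin r → ℝ) : CentralCharge r := ⟨θ, fun _ => 1, fun _ => one_pos⟩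

/-- The complex number `Z(a)`. -/
noncomputable def value (Z : CentralCharge r) (a : DimVec r) : ℂ :=
  -((∑ k, Z.θ k * a k : ℝ) : ℂ) + Complex.I * ((∑ k, Z.ρ k * a k : ℝ) : ℂ)

/-- The slope `μ_Z(a) = θ(a) / ρ(a)`. -/
noncomputable def slope (Z : CentralCharge r) (a : DimVec r) : ℝ :=
  (∑ k, Z.θ k * a k) / (∑ k, Z.ρ k * a k)

/-- `a <_Z b`. -/
def Lt (Z : CentralCharge r) (a b : DimVec r) : Prop := Z.slope a < Z.slope b

/-- `a ∼_Z b`. -/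
def Equiv (Z : CentralCharge r) (a b : DimVec r) : Prop := Z.slope a = Z.slope b

theorem rho_pos (Z : CentralCharge r) {a : DimVec r} (ha : a ≠ 0) : 0 < ∑ k, Z.ρ k * a k := by
  obtain ⟨i, hi⟩ := Function.ne_iff.1 ha
  refine Finset.sum_pos' (fun k _ => mul_nonneg (Z.ρ_pos k).le (Nat.cast_nonneg _))
    ⟨i, Finset.mem_univ i, mul_pos (Z.ρ_pos i) ?_⟩
  exact_mod_cast Nat.pos_of_ne_zero hi

/-- Comparing slopes is the same as comparing the arguments of the complex numbers `Z(a)`. -/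
theorem arg_lt_arg_iff (Z : CentralCharge r) {a b : DimVec r} (ha : a ≠ 0) (hb : b ≠ 0) :
    (Z.value a).arg < (Z.value b).arg ↔ Z.Lt a b := by
  have key : ∀ x y : ℝ, 0 < y →
      (-(x : ℂ) + Complex.I * (y : ℂ)).arg = Real.pi / 2 + Real.arctan (x / y) := by
    intro x y hy
    have hc := Real.cos_arctan_pos (x / y)
    have h : (-(x : ℂ) + Complex.I * (y : ℂ)) =
        ((y / Real.cos (Real.arctan (x / y)) : ℝ) : ℂ) *
          (Complex.cos ((Real.pi / 2 + Real.arctan (x / y) : ℝ) : ℂ) +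
            Complex.sin ((Real.pi / 2 + Real.arctan (x / y) : ℝ) : ℂ) * Complex.I) := by
      have h1 : Real.cos (Real.pi / 2 + Real.arctan (x / y)) = -Real.sin (Real.arctan (x / y)) := by
        rw [add_comm, Real.cos_add_pi_div_two]
      have h2 : Real.sin (Real.pi / 2 + Real.arctan (x / y)) = Real.cos (Real.arctan (x / y)) := by
        rw [add_comm, Real.sin_add_pi_div_two]
      have h3 : y * Real.sin (Real.arctan (x / y)) / Real.cos (Real.arctan (x / y)) = x := by
        rw [mul_div_assoc, ← Real.tan_eq_sin_div_cos, Real.tan_arctan, mul_div_cancel₀ _ hy.ne']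
      rw [← Complex.ofReal_cos, ← Complex.ofReal_sin, h1, h2]
      apply Complex.ext
      · simp [-Complex.ofReal_cos, -Complex.ofReal_sin, -Complex.ofReal_div]
        linarith [h3, div_mul_eq_mul_div y (Real.cos (Real.arctan (x / y)))
          (Real.sin (Real.arctan (x / y)))]
      · simp [-Complex.ofReal_cos, -Complex.ofReal_sin, -Complex.ofReal_div]
        field_simp
    rw [h]
    refine Complex.arg_mul_cos_add_sin_mul_I (div_pos hy hc) ⟨?_, ?_⟩
    · linarith [Real.neg_pi_div_two_lt_arctan (x / y), Real.pi_pos]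
    · linarith [Real.arctan_lt_pi_div_two (x / y)]
  unfold value Lt slope
  rw [key _ _ (Z.rho_pos ha), key _ _ (Z.rho_pos hb)]
  rw [add_lt_add_iff_left, Real.arctan_strictMono.lt_iff_lt]

end CentralCharge

/-! ### Donaldson-Thomas invariants -/

section Invariants

variable {r : ℕ}

open Classical in
/-- The Harder-Narasimhan collection `s_Z`: equal to `1` if `α₁ >_Z ⋯ >_Z αₙ`, and to `0`
otherwise. -/
noncomputable def hnColl (Z : CentralCharge r) : Coll r := fun α =>
  if α.Pairwise (fun a b => Z.Lt b a) then 1 else 0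

open Classical in
/-- The logarithmic collection `log_Z`: equal to `(-1)^(n-1) / n` if `α₁ ∼_Z ⋯ ∼_Z αₙ`, and to `0`
otherwise. -/
noncomputable def logColl (Z : CentralCharge r) : Coll r := fun α =>
  if α.Pairwise Z.Equiv then (-1) ^ (α.length - 1) / (α.length : ℚ) else 0

theorem sum_lt_of_mem_tuples {γ a : DimVec r} {α : List (DimVec r)} (hα : α ∈ tuples γ)
    (hl : 2 ≤ α.length) (ha : a ∈ α) : ∑ i, a i < ∑ i, γ i := by
  obtain ⟨h0, rfl⟩ := mem_tuples.1 hα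
  have hs : a + (α.erase a).sum = α.sum := by
    rw [← List.sum_cons, (List.perm_cons_erase ha).sum_eq]
  have h1 := DimVec.length_le_of_sum_eq (α.erase a) (fun h => h0 (List.mem_of_mem_erase h))
  rw [List.length_erase_of_mem ha] at h1
  rw [← hs]
  simp only [Pi.add_apply, Finset.sum_add_distrib]
  omega

theorem tuples_filter_short {γ : DimVec r} (hγ : γ ≠ 0) :
    (tuples γ).filter (fun α => ¬ 2 ≤ α.length) = {[γ]} := by
  ext α
  simp only [Finset.mem_filter, mem_tuples, Finset.mem_singleton]
  constructor
  · rintro ⟨⟨h0, hs⟩, hl⟩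
    match α, h0, hs, hl with
    | [], _, hs, _ => exact absurd hs.symm hγ
    | [a], _, hs, _ => simpa using hs
    | a :: b :: l, _, _, hl => simp at hl
  · rintro rfl
    simp [hγ.symm]

variable {R : Type*} [Ring R] [Algebra ℚ R]

/-- The stacky invariants `A_Z`, defined recursively by the basic wall-crossing formula
`A(γ) = ∑_{α₁ + ⋯ + αₙ = γ, α₁ >_Z ⋯ >_Z αₙ} A_Z(α₁) ⋯ A_Z(αₙ)`, in which the summand with `n = 1`
is `A_Z(γ)`; see `hnColl_act_stackyDT`. -/
noncomputable def stackyDT (Z : CentralCharge r) (A : DimVec r → R) (γ : DimVec r) : R :=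
  A γ - ∑ α ∈ ((tuples γ).filter (fun α => 2 ≤ α.length)).attach,
    hnColl Z α.1 • (α.1.attach.map (fun a => stackyDT Z A a.1)).prod
termination_by ∑ i, γ i
decreasing_by
  have h := Finset.mem_filter.1 α.2
  exact sum_lt_of_mem_tuples h.1 h.2 a.2

theorem stackyDT_eq (Z : CentralCharge r) (A : DimVec r → R) (γ : DimVec r) :
    stackyDT Z A γ = A γ - ∑ α ∈ (tuples γ).filter (fun α => 2 ≤ α.length),
      hnColl Z α • (α.map (stackyDT Z A)).prod := by
  rw [stackyDT, ← Finset.sum_attach ((tuples γ).filter (fun α => 2 ≤ α.length))]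
  congr 1
  refine Finset.sum_congr rfl fun α _ => ?_
  rw [List.map_attach_eq_pmap, List.pmap_eq_map]

/-- The basic wall-crossing formula `A = s_Z * A_Z`. -/
theorem hnColl_act_stackyDT (Z : CentralCharge r) (A : DimVec r → R) {γ : DimVec r} (hγ : γ ≠ 0) :
    (hnColl Z).act (stackyDT Z A) γ = A γ := by
  have h1 := tuples_filter_short hγ
  rw [Coll.act, ← Finset.sum_filter_add_sum_filter_not (tuples γ) (fun α => 2 ≤ α.length), h1,
    Finset.sum_singleton]
  have h2 : hnColl Z [γ] = 1 := by simp [hnColl]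
  rw [h2, List.map_singleton, List.prod_singleton, one_smul, stackyDT_eq Z A γ]
  abel

/-- The basic wall-crossing formula determines `A_Z`. -/
theorem stackyDT_unique (Z : CentralCharge r) (A B : DimVec r → R)
    (hB : ∀ γ : DimVec r, γ ≠ 0 → (hnColl Z).act B γ = A γ) (γ : DimVec r) (hγ : γ ≠ 0) :
    B γ = stackyDT Z A γ := by
  have h := (hB γ hγ).trans (hnColl_act_stackyDT Z A hγ).symm
  have h1 : (tuples γ).filter (fun α => ¬ 2 ≤ α.length) = {[γ]} := tuples_filter_short hγ
  rw [Coll.act, Coll.act, ← Finset.sum_filter_add_sum_filter_not (tuples γ) (fun α => 2 ≤ α.length),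
    ← Finset.sum_filter_add_sum_filter_not (tuples γ) (fun α => 2 ≤ α.length)
      (fun α => hnColl Z α • (α.map (stackyDT Z A)).prod), h1,
    Finset.sum_singleton, Finset.sum_singleton] at h
  have h2 : ∑ α ∈ (tuples γ).filter (fun α => 2 ≤ α.length), hnColl Z α • (α.map B).prod =
      ∑ α ∈ (tuples γ).filter (fun α => 2 ≤ α.length),
        hnColl Z α • (α.map (stackyDT Z A)).prod := by
    refine Finset.sum_congr rfl fun α hα => ?_
    have hα' := Finset.mem_filter.1 hα
    congr 2
    refine List.map_congr_left fun a ha => ?_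
    have hlt := sum_lt_of_mem_tuples hα'.1 hα'.2 ha
    exact stackyDT_unique Z A B hB a fun h0 => (mem_tuples.1 hα'.1).1 (h0 ▸ ha)
  have h3 : hnColl Z [γ] = 1 := by simp [hnColl]
  rw [h2, add_right_inj, h3] at h
  simpa using h
termination_by ∑ i, γ i

/-- The rational invariants `Ā_Z = log_Z * A_Z`. -/
noncomputable def rationalDT (Z : CentralCharge r) (A : DimVec r → R) : DimVec r → R :=
  (logColl Z).act (stackyDT Z A)

/-! ### Attractor invariants -/

/-- The stability parameter `θ` is generic: `a ∼_θ b` only if `a` and `b` are proportional. -/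
def IsGeneric (θ : Fin r → ℝ) : Prop :=
  ∀ a b : DimVec r, a ≠ 0 → b ≠ 0 → (CentralCharge.ofTheta θ).Equiv a b →
    ∃ m n : ℕ, 1 ≤ m ∧ 1 ≤ n ∧ m • a = n • b

/-- The self-stability `θ = ⟨-, γ⟩`. -/
def selfStability (ω : (Fin r → ℤ) →ₗ[ℤ] (Fin r → ℤ) →ₗ[ℤ] ℤ) (γ : DimVec r) : Fin r → ℝ :=
  fun k => (ω (Pi.single k 1) γ.toInt : ℝ)

/-- The filter of generic perturbations of `⟨-, γ⟩`: a property holds eventually along it if it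
holds for all generic parameters in some neighbourhood of `⟨-, γ⟩`. -/
def genericPerturbations (ω : (Fin r → ℤ) →ₗ[ℤ] (Fin r → ℤ) →ₗ[ℤ] ℤ) (γ : DimVec r) :
    Filter (Fin r → ℝ) :=
  𝓝[{θ | IsGeneric θ}] (selfStability ω γ)

/-- The attractor invariant `Ā_*(γ)`: the common value of `Ā_θ'(γ)` for all generic `θ'` close
enough to `⟨-, γ⟩`. -/
noncomputable def attractorDT (ω : (Fin r → ℤ) →ₗ[ℤ] (Fin r → ℤ) →ₗ[ℤ] ℤ) (A : DimVec r → R)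
    (γ : DimVec r) : R :=
  Classical.epsilon fun x : R =>
    ∀ᶠ θ' in genericPerturbations ω γ, rationalDT (CentralCharge.ofTheta θ') A γ = x

end Invariants

/-! ### Plane trees -/

/-- Plane rooted trees with leaves labelled by elements of `X`. -/
inductive PlaneTree (X : Type*) : Type _
  | leaf (x : X) : PlaneTree X
  | node (children : List (PlaneTree X)) : PlaneTree X

namespace PlaneTree

variable {X : Type*}

/-- The labels of the leaves, from left to right. -/
def leaves : PlaneTree X → List X
  | leaf x => [x]
  | node c => c.flatMap leaves

/-- The internal vertices, each recorded through its list of children, the root coming first. -/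
def vertices : PlaneTree X → List (List (PlaneTree X))
  | leaf _ => []
  | node c => c :: c.flatMap vertices

/-- All internal vertices have at least two children. -/
def IsReduced (T : PlaneTree X) : Prop := ∀ c ∈ T.vertices, 2 ≤ c.length

theorem leaves_ne_nil : ∀ T : PlaneTree X, T.IsReduced → T.leaves ≠ []
  | leaf x, _ => by simp [leaves]
  | node [], h => absurd (h [] (by simp [vertices])) (by simp)
  | node (u :: c), h => by
    have hu := leaves_ne_nil u fun d hd => h d (by simp [vertices, hd])
    simp [leaves, hu]

theorem finite_reduced (n : ℕ) : ∀ s : Set X, s.Finite →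
    {T : PlaneTree X | T.leaves.length ≤ n ∧ (∀ x ∈ T.leaves, x ∈ s) ∧ T.IsReduced}.Finite := by
  induction n with
  | zero =>
    intro s _
    refine Set.finite_empty.subset ?_
    rintro T ⟨h1, -, h3⟩
    exact leaves_ne_nil T h3 (List.length_eq_zero_iff.1 (Nat.le_zero.1 h1))
  | succ n ih =>
    intro s hs
    refine ((hs.image leaf).union ((finite_lists_of_mem (ih s hs) (n + 1)).image node)).subset ?_
    rintro (x | c) ⟨h1, h2, h3⟩
    · exact Or.inl ⟨x, h2 x (by simp [leaves]), rfl⟩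
    · right
      have hred : ∀ u ∈ c, u.IsReduced := fun u hu d hd =>
        h3 d (by simp only [vertices, List.mem_cons, List.mem_flatMap]; exact Or.inr ⟨u, hu, hd⟩)
      have hpos : ∀ u ∈ c, 1 ≤ u.leaves.length := fun u hu =>
        List.length_pos_iff.2 (leaves_ne_nil u (hred u hu))
      have hc : 2 ≤ c.length := h3 c (by simp [vertices])
      have hlen : ∀ l : List (PlaneTree X), (∀ u ∈ l, 1 ≤ u.leaves.length) →
          l.length ≤ (l.flatMap leaves).length := by
        intro l hl
        induction l with
        | nil => simp
        | cons u l ihl =>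
          have h4 := hl u (by simp)
          have h5 := ihl fun v hv => hl v (by simp [hv])
          simp only [List.flatMap_cons, List.length_append, List.length_cons]
          omega
      simp only [leaves] at h1 h2
      refine ⟨c, ⟨(hlen c hpos).trans h1, fun u hu => ⟨?_, ?_, hred u hu⟩⟩, rfl⟩
      · obtain ⟨l₁, l₂, rfl⟩ := List.append_of_mem hu
        have h4 := hlen l₁ fun v hv => hpos v (by simp [hv])
        have h5 := hlen l₂ fun v hv => hpos v (by simp [hv])
        simp only [List.flatMap_append, List.flatMap_cons, List.length_append,
          List.length_cons] at h1 hc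
        omega
      · exact fun x hx => h2 x (List.mem_flatMap.2 ⟨u, hu, hx⟩)

theorem finite_reduced_on (α : List X) :
    {T : PlaneTree X | T.leaves = α ∧ T.IsReduced}.Finite := by
  refine (finite_reduced α.length {x | x ∈ α} (List.finite_toSet α)).subset ?_
  rintro T ⟨rfl, h⟩
  exact ⟨le_rfl, fun x hx => hx, h⟩

/-- The plane rooted trees with leaves `1, …, n`, the leaf `i` carrying the label `αᵢ`, such that
all internal vertices have at least two children. -/
noncomputable def reducedOn (α : List X) : Finset (PlaneTree X) := (finite_reduced_on α).toFinset

theorem mem_reducedOn {α : List X} {T : PlaneTree X} :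
    T ∈ reducedOn α ↔ T.leaves = α ∧ T.IsReduced := by
  simp [reducedOn]

/-- The tuple `α|_{ch v}` attached to the vertex `v` with the list of children `c`: its entry at a
child `u` is the sum of the labels of the leaves below `u`. -/
def childTuple {r : ℕ} (c : List (PlaneTree (DimVec r))) : List (DimVec r) :=
  c.map fun u => u.leaves.sum

/-- The contribution
`(-1)^(|V(T)| - 1) (g(α|_{ch v₀}) - h(α|_{ch v₀})) ∏_{v ∈ V(T) \ {v₀}} h(α|_{ch v})`
of a tree `T` with root `v₀`. -/
def contribution {r : ℕ} (g h : Coll r) : PlaneTree (DimVec r) → ℚ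
  | leaf _ => 0
  | node c =>
    (-1) ^ ((node c).vertices.length - 1) * (g (childTuple c) - h (childTuple c)) *
      ((node c).vertices.tail.map fun c' => h (childTuple c')).prod

end PlaneTree

/-! ### The collections of the attractor tree formula -/

section TreeFormula

variable {r : ℕ}

open Classical in
/-- The number of `1 ≤ k < n` such that `P (α₁ + ⋯ + α_k) (α_{k+1} + ⋯ + αₙ)` holds. -/
noncomputable def cutCount (P : DimVec r → DimVec r → Prop) (α : List (DimVec r)) : ℕ :=
  ((Finset.Ico 1 α.length).filter fun k => P (α.take k).sum (α.drop k).sum).card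

/-- `t^{n₋} (t-1)^{n₊} (t^{n₀+1} - (t-1)^{n₀+1}) / (n₀+1)`. -/
def geometricValue (t : ℚ) (nPos nNeg nZero : ℕ) : ℚ :=
  t ^ nNeg * (t - 1) ^ nPos * ((t ^ (nZero + 1) - (t - 1) ^ (nZero + 1)) / (nZero + 1))

/-- The collection `g_{Z,t}`. -/
noncomputable def gColl (Z : CentralCharge r) (t : ℚ) : Coll r := fun α =>
  geometricValue t (cutCount (fun a b => Z.Lt b a) α) (cutCount (fun a b => Z.Lt a b) α)
    (cutCount (fun a b => Z.Equiv a b) α)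

/-- The collection `g_{*,t}`. -/
noncomputable def gStarColl (ω : (Fin r → ℤ) →ₗ[ℤ] (Fin r → ℤ) →ₗ[ℤ] ℤ) (t : ℚ) : Coll r := fun α =>
  geometricValue t (cutCount (fun a b => 0 < ω a.toInt b.toInt) α)
    (cutCount (fun a b => ω a.toInt b.toInt < 0) α)
    (cutCount (fun a b => ω a.toInt b.toInt = 0) α)

/-- The collection `F_{Z,t}`: equal to `1` at tuples of length one, and to a sum over plane trees
at longer tuples. -/
noncomputable def treeColl (ω : (Fin r → ℤ) →ₗ[ℤ] (Fin r → ℤ) →ₗ[ℤ] ℤ) (Z : CentralCharge r)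
    (t : ℚ) : Coll r := fun α =>
  if α.length = 1 then 1
  else ∑ T ∈ PlaneTree.reducedOn α, T.contribution (gColl Z t) (gStarColl ω t)

end TreeFormula

/-!
Write `G` for the generating series of `A`, a power series in `r` variables with coefficients in
`R`. For a central charge `Z` and `γ ≠ 0`, the Harder-Narasimhan recursion amounts to the unique
factorization `1 + G = u (1 + y) l` into series supported in slopes larger than, equal to and
smaller than that of `γ`, and `Ā_Z(γ)` is the coefficient of `log (1 + y)` at `γ`.

*A parametrization that does not depend on `Z`.* Choose `a` with
`(1 - t a)(1 + G) = 1 - (t - 1) a`. Let `ψ` be the additive function whose sign compares slopes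
with that of `γ`, and sum the products of the `a(αᵢ)` over all paths `α`, each partial sum `p`
being weighted by `t`, `t - 1` or `s + t` according as `ψ p` is negative, positive or zero.
Multiplied by `1 - t a` or by `1 - (t - 1) a`, the resulting series loses its part in `ψ < 0` or
in `ψ > 0`. Comparing the parts in `ψ = 0` shows that the paths with `ψ = 0` at their end sum to
`∑ₖ s^k y^(k+1)`. Integrating over `s ∈ [-1, 0]` turns the right-hand side into `log (1 + y)` and
the weights into `g_{Z,t}`, whence `Ā_Z = g_{Z,t} * a`.

*Attractor invariants.* If `Z'` is close to the self-stability `Z` of `γ`, then by uniqueness the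
factorization for `Z'` refines that for `Z`. Degrees of the same `Z`-slope as `γ` are orthogonal
to `γ`, so that the coefficient at `γ` is a trace on series in these degrees, `log` is additive
under it, and `Ā_{Z'}(γ) = Ā_Z(γ)`. Since `g_{Z,t}` and `g_{*,t}` agree on decompositions of `γ`,
this gives `Ā_* = g_{*,t} * a`.

The inverse of `g_{*,t}` under composition is a signed sum over plane trees; eliminating `a` from
the two formulas produces `F_{Z,t}`.
-/

/-! ### Power series indexed by dimension vectors -/

section Series

open Finset.HasAntidiagonal (antidiagonal mem_antidiagonal)

variable {r : ℕ}

noncomputable instance : Finset.HasAntidiagonal (DimVec r) :=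
  Finset.HasAntidiagonal.antidiagonalOfLocallyFinite

/-- The total degree of a dimension vector. -/
def DimVec.deg : DimVec r →+ ℕ where
  toFun a := ∑ i, a i
  map_zero' := by simp
  map_add' a b := by simp [Finset.sum_add_distrib]

theorem DimVec.deg_apply (a : DimVec r) : DimVec.deg a = ∑ i, a i := rfl

theorem DimVec.deg_eq_zero {a : DimVec r} : DimVec.deg a = 0 ↔ a = 0 := by
  simp [deg_apply, funext_iff]

theorem DimVec.deg_pos {a : DimVec r} (ha : a ≠ 0) : 0 < DimVec.deg a :=
  Nat.pos_of_ne_zero (mt DimVec.deg_eq_zero.1 ha)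

/-- The power series with given coefficients. -/
def seriesOf {R : Type*} (H : DimVec r → R) : MvPowerSeries (Fin r) R := fun n => H n

variable {R : Type*} [Ring R]

/-- The coefficient of a power series at a dimension vector. -/
noncomputable def coeffAt (a : DimVec r) : MvPowerSeries (Fin r) R →ₗ[R] R :=
  MvPowerSeries.coeff (Finsupp.equivFunOnFinite.symm a)

@[simp] theorem coeffAt_seriesOf (H : DimVec r → R) (a : DimVec r) :
    coeffAt a (seriesOf H) = H a := rfl

theorem series_ext {f g : MvPowerSeries (Fin r) R} (h : ∀ a, coeffAt a f = coeffAt a g) :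
    f = g := by
  refine MvPowerSeries.ext fun n => ?_
  simpa only [coeffAt, Finsupp.equivFunOnFinite_symm_coe] using h n

theorem coeffAt_zero (f : MvPowerSeries (Fin r) R) :
    coeffAt 0 f = MvPowerSeries.constantCoeff f := by
  rw [← MvPowerSeries.coeff_zero_eq_constantCoeff_apply]
  exact congrArg (MvPowerSeries.coeff · f) (Finsupp.ext fun _ => rfl)

theorem coeffAt_one (a : DimVec r) :
    coeffAt a (1 : MvPowerSeries (Fin r) R) = if a = 0 then 1 else 0 := by
  classical
  rw [coeffAt, MvPowerSeries.coeff_one]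
  simp only [Finsupp.ext_iff, funext_iff, Finsupp.equivFunOnFinite_symm_apply_apply,
    Finsupp.coe_zero, Pi.zero_apply]

@[simp] theorem coeffAt_zero_one : coeffAt 0 (1 : MvPowerSeries (Fin r) R) = 1 := by
  simp [coeffAt_one]

theorem coeffAt_mul (f g : MvPowerSeries (Fin r) R) (a : DimVec r) :
    coeffAt a (f * g) = ∑ p ∈ antidiagonal a, coeffAt p.1 f * coeffAt p.2 g := by
  classical
  let e : DimVec r ≃ (Fin r →₀ ℕ) := Finsupp.equivFunOnFinite.symm
  rw [coeffAt, MvPowerSeries.coeff_mul]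
  refine (Finset.sum_equiv (e.prodCongr e) (fun p => ?_) fun _ _ => rfl).symm
  simp only [mem_antidiagonal, Equiv.prodCongr_apply, Prod.map_fst, Prod.map_snd,
    Finsupp.ext_iff, funext_iff]
  rfl

@[simp] theorem coeffAt_zero_mul (f g : MvPowerSeries (Fin r) R) :
    coeffAt 0 (f * g) = coeffAt 0 f * coeffAt 0 g := by
  rw [coeffAt_mul, Finset.HasAntidiagonal.antidiagonal_zero, Finset.sum_singleton]

theorem exists_inverse {f : MvPowerSeries (Fin r) R} (hf : coeffAt 0 f = 1) :
    ∃ g, f * g = 1 ∧ g * f = 1 ∧ coeffAt 0 g = 1 := by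
  rw [coeffAt_zero] at hf
  exact ⟨MvPowerSeries.invOfUnit f 1, MvPowerSeries.mul_invOfUnit f 1 hf,
    MvPowerSeries.invOfUnit_mul f 1 hf, by simp [coeffAt_zero]⟩

theorem coeffAt_pow_eq_zero {f : MvPowerSeries (Fin r) R} (hf : coeffAt 0 f = 0) {n : ℕ}
    {a : DimVec r} (h : DimVec.deg a < n) : coeffAt a (f ^ n) = 0 := by
  rw [coeffAt_zero] at hf
  refine MvPowerSeries.coeff_of_lt_order
    (lt_of_lt_of_le ?_ (MvPowerSeries.le_order_pow_of_constantCoeff_eq_zero n hf))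
  rw [Finsupp.degree_eq_sum]
  exact_mod_cast h

theorem coeffAt_mul_pow_eq_zero {f : MvPowerSeries (Fin r) R} (hf : coeffAt 0 f = 0) {n : ℕ}
    {a : DimVec r} (h : DimVec.deg a < n) (g : MvPowerSeries (Fin r) R) :
    coeffAt a (g * f ^ n) = 0 := by
  rw [coeffAt_mul]
  refine Finset.sum_eq_zero fun p hp => ?_
  rw [← mem_antidiagonal.1 hp, map_add] at h
  rw [coeffAt_pow_eq_zero hf (by omega), mul_zero]

/-- The generating series of `H` in nonzero degrees. -/
def augSeries {R : Type*} [Zero R] (H : DimVec r → R) : MvPowerSeries (Fin r) R :=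
  seriesOf fun a => if a = 0 then 0 else H a

theorem coeffAt_augSeries (H : DimVec r → R) (a : DimVec r) :
    coeffAt a (augSeries H) = if a = 0 then 0 else H a := rfl

@[simp] theorem coeffAt_zero_augSeries (H : DimVec r → R) : coeffAt 0 (augSeries H) = 0 :=
  if_pos rfl

variable [Algebra ℚ R]

@[simp] theorem coeffAt_smul (q : ℚ) (f : MvPowerSeries (Fin r) R) (a : DimVec r) :
    coeffAt a (q • f) = q • coeffAt a f := rfl

/-! ### Series with coefficients in a graded family -/

/-- The power series whose coefficient at each `a` lies in `C a`. Conditions on coefficients and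
conditions on supports are both of this form. -/
def gradedSeries (C : DimVec r → Submodule ℚ R) [SetLike.GradedMonoid C] :
    Subalgebra ℚ (MvPowerSeries (Fin r) R) where
  carrier := {f | ∀ a, coeffAt a f ∈ C a}
  add_mem' hf hg a := by rw [map_add]; exact (C a).add_mem (hf a) (hg a)
  mul_mem' hf hg a := by
    rw [coeffAt_mul]
    refine (C a).sum_mem fun p hp => ?_
    rw [← mem_antidiagonal.1 hp]
    exact SetLike.mul_mem_graded (hf _) (hg _)
  algebraMap_mem' q a := by
    rw [Algebra.algebraMap_eq_smul_one, coeffAt_smul, coeffAt_one]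
    split_ifs with h
    · exact (C a).smul_mem q (h ▸ SetLike.one_mem_graded C)
    · exact (C a).smul_mem q (C a).zero_mem

variable {C : DimVec r → Submodule ℚ R} [SetLike.GradedMonoid C]

theorem mem_gradedSeries_of_mul_eq_one {f g : MvPowerSeries (Fin r) R} (hf : f ∈ gradedSeries C)
    (hf0 : coeffAt 0 f = 1) (h : f * g = 1) : g ∈ gradedSeries C := by
  intro a
  induction hn : DimVec.deg a using Nat.strong_induction_on generalizing a with
  | _ n ih =>
    have hg : g = 1 - (f - 1) * g := by rw [sub_mul, h]; noncomm_ring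
    rw [hg, map_sub, coeffAt_mul]
    refine (C a).sub_mem (one_mem (gradedSeries C) a) ((C a).sum_mem fun p hp => ?_)
    rw [← mem_antidiagonal.1 hp]
    rcases eq_or_ne p.1 0 with h0 | h0
    · simp [h0, hf0]
    · refine SetLike.mul_mem_graded (sub_mem hf (one_mem _) p.1) (ih _ ?_ p.2 rfl)
      have := DimVec.deg_pos h0
      rw [← hn, ← mem_antidiagonal.1 hp, map_add]
      omega

/-- The graded family equal to `R` in the degrees belonging to `M`, and zero elsewhere. -/
noncomputable def supportFamily (R : Type*) [Ring R] [Algebra ℚ R] (M : AddSubmonoid (DimVec r)) :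
    DimVec r → Submodule ℚ R :=
  open Classical in fun a => if a ∈ M then ⊤ else ⊥

theorem mem_supportFamily {M : AddSubmonoid (DimVec r)} {a : DimVec r} {x : R} :
    x ∈ supportFamily R M a ↔ (a ∉ M → x = 0) := by
  unfold supportFamily
  split_ifs with h <;> simp [h]

instance supportFamily.gradedMonoid (M : AddSubmonoid (DimVec r)) :
    SetLike.GradedMonoid (supportFamily R M) where
  one_mem := mem_supportFamily.2 fun h => absurd M.zero_mem h
  mul_mem a b x y hx hy := mem_supportFamily.2 fun h => by
    rw [mem_supportFamily] at hx hy
    by_cases ha : a ∈ M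
    · rw [hy fun hb => h (M.add_mem ha hb), mul_zero]
    · rw [hx ha, zero_mul]

/-- The power series supported on `M`. -/
noncomputable def supportedSeries (R : Type*) [Ring R] [Algebra ℚ R]
    (M : AddSubmonoid (DimVec r)) : Subalgebra ℚ (MvPowerSeries (Fin r) R) :=
  gradedSeries (supportFamily R M)

theorem mem_supportedSeries {M : AddSubmonoid (DimVec r)} {f : MvPowerSeries (Fin r) R} :
    f ∈ supportedSeries R M ↔ ∀ a ∉ M, coeffAt a f = 0 :=
  forall_congr' fun _ => mem_supportFamily

theorem supportedSeries_mono {M N : AddSubmonoid (DimVec r)} (h : M ≤ N) :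
    supportedSeries R M ≤ supportedSeries R N := fun _ hf =>
  mem_supportedSeries.2 fun a ha => mem_supportedSeries.1 hf a fun haM => ha (h haM)

end Series

/-! ### The power series of a collection -/

section CollSeries

open Finset.HasAntidiagonal (antidiagonal mem_antidiagonal)

variable {r : ℕ} {R : Type*} [Ring R] [Algebra ℚ R]

theorem act_mem {C : DimVec r → Submodule ℚ R} [SetLike.GradedMonoid C] {F : Coll r}
    {H : DimVec r → R} {a : DimVec r} (h : ∀ α ∈ tuples a, F α ≠ 0 → ∀ b ∈ α, H b ∈ C b) :
    F.act H a ∈ C a := by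
  refine (C a).sum_mem fun α hα => ?_
  by_cases hF : F α = 0
  · simp [hF]
  · have hprod := SetLike.list_prod_map_mem_graded α id H (h α hα hF)
    rw [List.map_id, (mem_tuples.1 hα).2] at hprod
    exact (C a).smul_mem _ hprod

theorem stackyDT_mem {C : DimVec r → Submodule ℚ R} [SetLike.GradedMonoid C]
    (Z : CentralCharge r) {A : DimVec r → R} (hA : ∀ a, a ≠ 0 → A a ∈ C a) :
    ∀ a, a ≠ 0 → stackyDT Z A a ∈ C a := by
  intro a
  induction hn : DimVec.deg a using Nat.strong_induction_on generalizing a with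
  | _ n ih =>
    intro ha
    have hlong : Coll.act (fun α => if 2 ≤ α.length then hnColl Z α else 0) (stackyDT Z A) a ∈
        C a := by
      refine act_mem fun α hα hF b hb => ?_
      have hl : 2 ≤ α.length := by by_contra hl; simp [hl] at hF
      exact ih _ (hn ▸ sum_lt_of_mem_tuples hα hl hb) b rfl
        (ne_of_mem_of_not_mem hb (mem_tuples.1 hα).1)
    simp only [Coll.act, ite_smul, zero_smul, ← Finset.sum_filter] at hlong
    rw [stackyDT_eq]
    exact (C a).sub_mem (hA a ha) hlong

namespace Coll

theorem act_congr {F G : Coll r} {H K : DimVec r → R} {a : DimVec r}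
    (hFG : ∀ α ∈ tuples a, F α = G α) (hHK : ∀ b, b ≠ 0 → H b = K b) : F.act H a = G.act K a := by
  refine Finset.sum_congr rfl fun α hα => ?_
  rw [hFG α hα, List.map_congr_left fun b hb =>
    hHK b (ne_of_mem_of_not_mem hb (mem_tuples.1 hα).1)]

theorem act_zero (F : Coll r) (H : DimVec r → R) : F.act H 0 = F [] • 1 := by
  have htuples : tuples (0 : DimVec r) = {[]} := by
    ext α
    rw [mem_tuples, Finset.mem_singleton]
    refine ⟨fun ⟨h0, h⟩ => ?_, by rintro rfl; simp⟩
    simpa [h] using DimVec.length_le_of_sum_eq α h0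
  simp [act, htuples]

/-- The power series with coefficients `(F * H)(γ)`. -/
noncomputable def series (F : Coll r) (H : DimVec r → R) : MvPowerSeries (Fin r) R :=
  seriesOf (F.act H)

@[simp] theorem coeffAt_series (F : Coll r) (H : DimVec r → R) (a : DimVec r) :
    coeffAt a (F.series H) = F.act H a := rfl

theorem series_congr {F G : Coll r} {H K : DimVec r → R}
    (hFG : ∀ α : List (DimVec r), 0 ∉ α → F α = G α) (hHK : ∀ b, b ≠ 0 → H b = K b) :
    F.series H = G.series K :=
  series_ext fun _ => act_congr (fun α hα => hFG α (mem_tuples.1 hα).1) hHK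

/-- The convolution product of collections, corresponding to the product of power series. -/
def conv (F G : Coll r) : Coll r := fun α =>
  ∑ k ∈ Finset.range (α.length + 1), F (α.take k) * G (α.drop k)

end Coll

theorem sum_antidiagonal_sum_tuples {M : Type*} [AddCommMonoid M] (a : DimVec r)
    (φ : List (DimVec r) → List (DimVec r) → M) :
    ∑ p ∈ antidiagonal a, ∑ α ∈ tuples p.1, ∑ β ∈ tuples p.2, φ α β =
      ∑ α ∈ tuples a, ∑ k ∈ Finset.range (α.length + 1), φ (α.take k) (α.drop k) := by
  simp only [← Finset.sum_product']
  rw [Finset.sum_sigma', Finset.sum_sigma']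
  refine Finset.sum_bij' (fun x _ => ⟨x.2.1 ++ x.2.2, x.2.1.length⟩)
    (fun x _ => ⟨((x.1.take x.2).sum, (x.1.drop x.2).sum), (x.1.take x.2, x.1.drop x.2)⟩)
    ?_ ?_ ?_ ?_ ?_
  · rintro ⟨p, α, β⟩ hx
    simp only [Finset.mem_sigma, mem_antidiagonal, Finset.mem_product, mem_tuples,
      Finset.mem_range] at hx ⊢
    obtain ⟨rfl, ⟨hα, hαs⟩, hβ, hβs⟩ := hx
    simp [hα, hαs, hβ, hβs]
  · rintro ⟨α, k⟩ hx
    simp only [Finset.mem_sigma, mem_antidiagonal, Finset.mem_product, mem_tuples] at hx ⊢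
    refine ⟨?_, ⟨fun h => hx.1.1 (List.mem_of_mem_take h), trivial⟩,
      fun h => hx.1.1 (List.mem_of_mem_drop h), trivial⟩
    rw [← List.sum_append, List.take_append_drop, hx.1.2]
  · rintro ⟨p, α, β⟩ hx
    simp only [Finset.mem_sigma, mem_antidiagonal, Finset.mem_product, mem_tuples] at hx
    obtain ⟨rfl, ⟨-, hα⟩, -, hβ⟩ := hx
    simp [hα, hβ]
  · rintro ⟨α, k⟩ hx
    simp only [Finset.mem_sigma, Finset.mem_range] at hx
    simp [Nat.min_eq_left (Nat.le_of_lt_succ hx.2)]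
  · rintro ⟨p, α, β⟩ -
    simp

theorem Coll.series_mul_series (F G : Coll r) (H : DimVec r → R) :
    F.series H * G.series H = (F.conv G).series H := by
  refine series_ext fun a => ?_
  simp only [coeffAt_mul, coeffAt_series, act, Finset.sum_mul_sum, smul_mul_smul_comm,
    ← List.prod_append, ← List.map_append]
  rw [sum_antidiagonal_sum_tuples a fun α β => (F α * G β) • ((α ++ β).map H).prod]
  simp only [List.take_append_drop, conv, Finset.sum_smul]

/-- The collection equal to `1` on tuples of length `n`, and to `0` elsewhere. -/
def lengthColl (r n : ℕ) : Coll r := fun α => if α.length = n then 1 else 0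

theorem series_lengthColl_zero (H : DimVec r → R) : (lengthColl r 0).series H = 1 := by
  refine series_ext fun a => ?_
  rw [Coll.coeffAt_series, coeffAt_one]
  split_ifs with h
  · simp [h, Coll.act_zero, lengthColl]
  · refine Finset.sum_eq_zero fun α hα => ?_
    rw [lengthColl, if_neg, zero_smul]
    intro hl
    rw [List.length_eq_zero_iff.1 hl, mem_tuples] at hα
    exact h hα.2.symm

theorem series_lengthColl_one (H : DimVec r → R) : (lengthColl r 1).series H = augSeries H := by
  refine series_ext fun a => ?_
  rw [Coll.coeffAt_series, coeffAt_augSeries]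
  split_ifs with ha
  · simp [ha, Coll.act_zero, lengthColl]
  · rw [Coll.act, Finset.sum_eq_single [a]]
    · simp [lengthColl]
    · intro α hα hne
      rw [lengthColl, if_neg, zero_smul]
      intro h
      obtain ⟨b, rfl⟩ := List.length_eq_one_iff.1 h
      exact hne (by simpa using (mem_tuples.1 hα).2)
    · exact fun h => absurd (mem_tuples.2 ⟨by simpa using Ne.symm ha, by simp⟩) h

theorem Coll.conv_lengthColl_one (F : Coll r) (α : List (DimVec r)) :
    F.conv (lengthColl r 1) α = if α = [] then 0 else F α.dropLast := by
  split_ifs with h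
  · simp [h, conv, lengthColl]
  · have hl := List.length_pos_iff.2 h
    rw [conv, Finset.sum_eq_single (α.length - 1)]
    · simp [lengthColl, Nat.sub_sub_self hl, List.dropLast_eq_take]
    · intro k hk hne
      rw [Finset.mem_range] at hk
      have : ¬ α.length - k = 1 := by omega
      simp [lengthColl, this]
    · simp

theorem augSeries_pow (H : DimVec r → R) (n : ℕ) :
    augSeries H ^ n = (lengthColl r n).series H := by
  induction n with
  | zero => rw [pow_zero, series_lengthColl_zero]
  | succ n ih =>
    rw [pow_succ, ih, ← series_lengthColl_one, Coll.series_mul_series]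
    refine Coll.series_congr (fun α _ => ?_) fun _ _ => rfl
    rw [Coll.conv_lengthColl_one]
    cases α with
    | nil => simp [lengthColl]
    | cons a α => simp [lengthColl]

end CollSeries

/-! ### Factorization of a series with respect to a slope -/

namespace CentralCharge

variable {r : ℕ}

/-- The additive function whose sign at `a` compares the slope of `a` with the slope of `γ`. -/
noncomputable def offset (Z : CentralCharge r) (γ : DimVec r) : DimVec r →+ ℝ where
  toFun a := (∑ k, Z.θ k * a k) * (∑ k, Z.ρ k * γ k) - (∑ k, Z.θ k * γ k) * (∑ k, Z.ρ k * a k)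
  map_zero' := by simp
  map_add' a b := by
    simp only [Pi.add_apply, Nat.cast_add, mul_add, Finset.sum_add_distrib]
    ring

theorem offset_apply (Z : CentralCharge r) (γ a : DimVec r) : Z.offset γ a =
    (∑ k, Z.θ k * a k) * (∑ k, Z.ρ k * γ k) - (∑ k, Z.θ k * γ k) * (∑ k, Z.ρ k * a k) := rfl

@[simp] theorem offset_self (Z : CentralCharge r) (γ : DimVec r) : Z.offset γ γ = 0 := sub_self _

theorem offset_pos_iff (Z : CentralCharge r) {γ a : DimVec r} (hγ : γ ≠ 0) (ha : a ≠ 0) :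
    0 < Z.offset γ a ↔ Z.slope γ < Z.slope a := by
  rw [slope, slope, div_lt_div_iff₀ (Z.rho_pos hγ) (Z.rho_pos ha), offset_apply, sub_pos]

theorem offset_neg_iff (Z : CentralCharge r) {γ a : DimVec r} (hγ : γ ≠ 0) (ha : a ≠ 0) :
    Z.offset γ a < 0 ↔ Z.slope a < Z.slope γ := by
  rw [slope, slope, div_lt_div_iff₀ (Z.rho_pos ha) (Z.rho_pos hγ), offset_apply, sub_neg]

theorem offset_eq_zero_iff (Z : CentralCharge r) {γ a : DimVec r} (hγ : γ ≠ 0) (ha : a ≠ 0) :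
    Z.offset γ a = 0 ↔ Z.slope a = Z.slope γ := by
  rw [slope, slope, div_eq_div_iff (Z.rho_pos ha).ne' (Z.rho_pos hγ).ne', offset_apply, sub_eq_zero]

theorem slope_sum_eq (Z : CentralCharge r) {b : DimVec r} (hb : b ≠ 0) {α : List (DimVec r)}
    (h0 : 0 ∉ α) (h : ∀ a ∈ α, Z.slope a = Z.slope b) (hα : α.sum ≠ 0) :
    Z.slope α.sum = Z.slope b := by
  rw [← Z.offset_eq_zero_iff hb hα, map_list_sum]
  refine List.sum_eq_zero fun x hx => ?_
  obtain ⟨a, ha, rfl⟩ := List.mem_map.1 hx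
  exact (Z.offset_eq_zero_iff hb (ne_of_mem_of_not_mem ha h0)).2 (h a ha)

theorem pairwise_equiv_iff (Z : CentralCharge r) {γ : DimVec r} (hγ : γ ≠ 0)
    {α : List (DimVec r)} (hα : α ∈ tuples γ) :
    α.Pairwise Z.Equiv ↔ ∀ a ∈ α, Z.slope a = Z.slope γ := by
  obtain ⟨h0, rfl⟩ := mem_tuples.1 hα
  refine ⟨fun h => ?_, fun h => List.pairwise_of_forall_mem_list fun a ha b hb =>
    (h a ha).trans (h b hb).symm⟩
  cases α with
  | nil => simp
  | cons b α =>
    have hb : ∀ a ∈ b :: α, Z.slope a = Z.slope b :=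
      List.forall_mem_cons.2 ⟨rfl, fun a ha => ((List.pairwise_cons.1 h).1 a ha).symm⟩
    intro a ha
    rw [hb a ha, Z.slope_sum_eq (ne_of_mem_of_not_mem List.mem_cons_self h0) h0 hb hγ]

end CentralCharge

theorem filter_append_filter_not {X : Type*} (p : X → Bool) :
    ∀ {l : List X}, l.Pairwise (fun a b => p b → p a) → l.filter p ++ l.filter (!p ·) = l
  | [], _ => rfl
  | a :: l, h => by
    obtain ⟨ha, hl⟩ := List.pairwise_cons.1 h
    by_cases hpa : p a
    · simp [hpa, filter_append_filter_not p hl]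
    · have hpl : ∀ b ∈ l, ¬ p b := fun b hb hpb => hpa (ha b hb hpb)
      rw [List.filter_cons_of_neg hpa, List.filter_eq_nil_iff.2 hpl, List.nil_append,
        List.filter_eq_self.2]
      exact List.forall_mem_cons.2 ⟨by simp [hpa], fun b hb => by simp [hpl b hb]⟩

section HarderNarasimhan

variable {r : ℕ}

/-- The tuples of strictly decreasing slopes, all lying in `J`. -/
def IsHN (Z : CentralCharge r) (J : Set ℝ) (α : List (DimVec r)) : Prop :=
  α.Pairwise (fun a b => Z.Lt b a) ∧ ∀ a ∈ α, Z.slope a ∈ J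

open Classical in
/-- The Harder-Narasimhan collection, restricted to tuples with slopes in `J`. -/
noncomputable def hnCollOn (Z : CentralCharge r) (J : Set ℝ) : Coll r := fun α =>
  if IsHN Z J α then 1 else 0

theorem hnCollOn_ne_zero {Z : CentralCharge r} {J : Set ℝ} {α : List (DimVec r)} :
    hnCollOn Z J α ≠ 0 ↔ IsHN Z J α := by
  simp [hnCollOn]

theorem hnCollOn_univ (Z : CentralCharge r) : hnCollOn Z Set.univ = hnColl Z := by
  funext α
  unfold hnCollOn hnColl IsHN
  congr 1
  simp

open Classical in
theorem isHN_append_iff {Z : CentralCharge r} {J K : Set ℝ} (hJK : ∀ x ∈ J, ∀ y ∈ K, y < x)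
    {β δ : List (DimVec r)} :
    IsHN Z J β ∧ IsHN Z K δ ↔
      IsHN Z (J ∪ K) (β ++ δ) ∧ β.length = ((β ++ δ).filter (Z.slope · ∈ J)).length := by
  have hdisj : ∀ x ∈ K, x ∉ J := fun x hK hJ => lt_irrefl x (hJK x hJ x hK)
  constructor
  · rintro ⟨⟨hβ, hβJ⟩, hδ, hδK⟩
    refine ⟨⟨List.pairwise_append.2 ⟨hβ, hδ, fun a ha b hb => hJK _ (hβJ a ha) _ (hδK b hb)⟩,
      fun a ha => (List.mem_append.1 ha).imp (hβJ a) (hδK a)⟩, ?_⟩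
    rw [List.filter_append, List.filter_eq_self.2 fun a ha => by simpa using hβJ a ha,
      List.filter_eq_nil_iff.2 fun a ha => by simpa using hdisj _ (hδK a ha), List.append_nil]
  · rintro ⟨⟨hp, hm⟩, hlen⟩
    have hpJ : (β ++ δ).Pairwise fun a b => decide (Z.slope b ∈ J) → decide (Z.slope a ∈ J) := by
      refine hp.imp_of_mem fun {a b} ha _ hba hb => ?_
      simp only [decide_eq_true_eq] at hb ⊢
      exact (hm a ha).resolve_right fun haK => lt_asymm hba (hJK _ hb _ haK)
    obtain ⟨hβ, hδ⟩ := List.append_inj (filter_append_filter_not _ hpJ) hlen.symm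
    refine ⟨⟨hp.sublist (List.sublist_append_left β δ), fun a ha => ?_⟩,
      hp.sublist (List.sublist_append_right β δ), fun a ha => ?_⟩
    · rw [← hβ] at ha
      simpa using (List.mem_filter.1 ha).2
    · refine (hm a (List.mem_append_right β ha)).resolve_left ?_
      rw [← hδ] at ha
      simpa using (List.mem_filter.1 ha).2

theorem conv_hnCollOn (Z : CentralCharge r) {J K : Set ℝ} (hJK : ∀ x ∈ J, ∀ y ∈ K, y < x) :
    (hnCollOn Z J).conv (hnCollOn Z K) = hnCollOn Z (J ∪ K) := by
  classical
  funext α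
  have hterm : ∀ k ∈ Finset.range (α.length + 1),
      hnCollOn Z J (α.take k) * hnCollOn Z K (α.drop k) =
        if (α.filter (Z.slope · ∈ J)).length = k then hnCollOn Z (J ∪ K) α else 0 := by
    intro k hk
    have h := isHN_append_iff (Z := Z) hJK (β := α.take k) (δ := α.drop k)
    rw [List.take_append_drop, List.length_take_of_le (Finset.mem_range_succ_iff.1 hk),
      eq_comm (a := k), and_comm (a := IsHN Z (J ∪ K) α)] at h
    simp only [hnCollOn, ← ite_and, mul_ite, mul_one, mul_zero, ← h, and_comm]
  rw [Coll.conv, Finset.sum_congr rfl hterm, Finset.sum_ite_eq, if_pos]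
  exact Finset.mem_range_succ_iff.2 (List.length_filter_le _ α)

variable {R : Type*} [Ring R] [Algebra ℚ R]

/-- The factor of `1 + A` coming from the slopes in `J`. -/
noncomputable def slopeFactor (Z : CentralCharge r) (A : DimVec r → R) (J : Set ℝ) :
    MvPowerSeries (Fin r) R :=
  (hnCollOn Z J).series (stackyDT Z A)

theorem slopeFactor_mul (Z : CentralCharge r) (A : DimVec r → R) {J K : Set ℝ}
    (hJK : ∀ x ∈ J, ∀ y ∈ K, y < x) :
    slopeFactor Z A J * slopeFactor Z A K = slopeFactor Z A (J ∪ K) := by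
  rw [slopeFactor, slopeFactor, Coll.series_mul_series, conv_hnCollOn Z hJK, slopeFactor]

@[simp] theorem coeffAt_zero_slopeFactor (Z : CentralCharge r) (A : DimVec r → R) (J : Set ℝ) :
    coeffAt 0 (slopeFactor Z A J) = 1 := by
  simp [slopeFactor, Coll.act_zero, hnCollOn, IsHN]

theorem slopeFactor_univ (Z : CentralCharge r) (A : DimVec r → R) :
    slopeFactor Z A Set.univ = 1 + augSeries A := by
  refine series_ext fun a => ?_
  rcases eq_or_ne a 0 with rfl | ha
  · simp
  · rw [slopeFactor, hnCollOn_univ, Coll.coeffAt_series, hnColl_act_stackyDT Z A ha, map_add,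
      coeffAt_one, coeffAt_augSeries, if_neg ha, if_neg ha, zero_add]

theorem slopeFactor_mem {C : DimVec r → Submodule ℚ R} [SetLike.GradedMonoid C]
    {Z : CentralCharge r} {A : DimVec r → R} {J : Set ℝ}
    (h : ∀ a, a ≠ 0 → Z.slope a ∈ J → stackyDT Z A a ∈ C a) :
    slopeFactor Z A J ∈ gradedSeries C := fun _ =>
  act_mem fun _ hα hJ b hb => h b (ne_of_mem_of_not_mem hb (mem_tuples.1 hα).1)
    ((hnCollOn_ne_zero.1 hJ).2 b hb)

/-- The part of `A_Z` of slope `x`. -/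
noncomputable def slopePart (Z : CentralCharge r) (A : DimVec r → R) (x : ℝ) (a : DimVec r) : R :=
  open Classical in if Z.slope a = x then stackyDT Z A a else 0

theorem slopeFactor_singleton (Z : CentralCharge r) (A : DimVec r → R) (x : ℝ) :
    slopeFactor Z A {x} = 1 + augSeries (slopePart Z A x) := by
  refine series_ext fun a => ?_
  rcases eq_or_ne a 0 with rfl | ha
  · simp
  rw [map_add, coeffAt_one, coeffAt_augSeries, if_neg ha, if_neg ha, zero_add, slopeFactor,
    Coll.coeffAt_series, Coll.act, Finset.sum_eq_single [a]]
  · simp [hnCollOn, IsHN, slopePart]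
  · intro α hα hne
    suffices h : ¬ IsHN Z {x} α by rw [not_ne_iff.1 (mt hnCollOn_ne_zero.1 h), zero_smul]
    rintro ⟨hp, hm⟩
    match α, (mem_tuples.1 hα).2, hne, hp, hm with
    | [], hs, _, _, _ => exact ha hs.symm
    | [b], hs, hne, _, _ => exact hne (by simpa using hs)
    | b :: c :: l, _, _, hp, hm =>
      have hlt : Z.slope c < Z.slope b := (List.pairwise_cons.1 hp).1 c (by simp)
      rw [hm b (by simp), hm c (by simp)] at hlt
      exact lt_irrefl x hlt
  · exact fun h => absurd (mem_tuples.2 ⟨by simpa using ha.symm, by simp⟩) h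

theorem slopeFactor_mul_mul (Z : CentralCharge r) (A : DimVec r → R) (x : ℝ) :
    slopeFactor Z A (Set.Ioi x) * slopeFactor Z A {x} * slopeFactor Z A (Set.Iio x) =
      1 + augSeries A := by
  rw [← slopeFactor_univ Z,
    slopeFactor_mul Z A fun y hy z hz => by rwa [Set.mem_singleton_iff.1 hz],
    slopeFactor_mul Z A fun y hy z hz => ?_, Set.Ioi_union_left, Set.Ici_union_Iio]
  rw [Set.Ioi_union_left] at hy
  exact lt_of_lt_of_le hz hy

end HarderNarasimhan

/-! ### Uniqueness of factorizations -/

section Factorization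

open Finset.HasAntidiagonal (antidiagonal mem_antidiagonal)

variable {r : ℕ} {R : Type*} [Ring R]

theorem coeffAt_mul_congr {f f' g g' : MvPowerSeries (Fin r) R} {a : DimVec r}
    (hf : ∀ b ≤ a, coeffAt b f = coeffAt b f') (hg : ∀ b ≤ a, coeffAt b g = coeffAt b g') :
    coeffAt a (f * g) = coeffAt a (f' * g') := by
  rw [coeffAt_mul, coeffAt_mul]
  refine Finset.sum_congr rfl fun p hp => ?_
  have hp := mem_antidiagonal.1 hp
  rw [hf p.1 (hp ▸ le_self_add), hg p.2 (hp ▸ le_add_self)]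

theorem coeffAt_mul_eq_mul_coeffAt_zero {d : MvPowerSeries (Fin r) R} {a : DimVec r}
    (hd : ∀ b < a, coeffAt b d = 0) (f : MvPowerSeries (Fin r) R) :
    coeffAt a (d * f) = coeffAt a d * coeffAt 0 f := by
  rw [coeffAt_mul, Finset.sum_eq_single (a, 0)]
  · rintro ⟨p, q⟩ hp hne
    have hp : p + q = a := mem_antidiagonal.1 hp
    have hpa : p ≠ a := by
      rintro rfl
      exact hne (by simpa using hp)
    rw [hd p (lt_of_le_of_ne (hp ▸ le_self_add) hpa), zero_mul]
  · exact fun h => absurd (mem_antidiagonal.2 (add_zero a)) h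

theorem coeffAt_mul_eq_coeffAt_zero_mul {d : MvPowerSeries (Fin r) R} {a : DimVec r}
    (hd : ∀ b < a, coeffAt b d = 0) (f : MvPowerSeries (Fin r) R) :
    coeffAt a (f * d) = coeffAt 0 f * coeffAt a d := by
  rw [coeffAt_mul, Finset.sum_eq_single (0, a)]
  · rintro ⟨p, q⟩ hp hne
    have hp : p + q = a := mem_antidiagonal.1 hp
    have hqa : q ≠ a := by
      rintro rfl
      exact hne (by simpa using hp)
    rw [hd q (lt_of_le_of_ne (hp ▸ le_add_self) hqa), mul_zero]
  · exact fun h => absurd (mem_antidiagonal.2 (zero_add a)) h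

theorem coeffAt_mul_sub_coeffAt_mul {f f' g g' : MvPowerSeries (Fin r) R} {a : DimVec r}
    (hf : ∀ b < a, coeffAt b f = coeffAt b f') (hg : ∀ b < a, coeffAt b g = coeffAt b g')
    (hf0 : coeffAt 0 f' = 1) (hg0 : coeffAt 0 g = 1) :
    coeffAt a (f * g) - coeffAt a (f' * g') =
      (coeffAt a f - coeffAt a f') + (coeffAt a g - coeffAt a g') := by
  have hsplit : f * g - f' * g' = (f - f') * g + f' * (g - g') := by noncomm_ring
  rw [← map_sub, hsplit, map_add,
    coeffAt_mul_eq_mul_coeffAt_zero (fun b hb => by rw [map_sub, hf b hb, sub_self]),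
    coeffAt_mul_eq_coeffAt_zero_mul (fun b hb => by rw [map_sub, hg b hb, sub_self]),
    hf0, hg0, mul_one, one_mul, map_sub, map_sub]

/-- The dimension vectors on which `ψ` is positive, together with `0`. -/
def posCone (ψ : DimVec r →+ ℝ) : AddSubmonoid (DimVec r) where
  carrier := {a | a = 0 ∨ 0 < ψ a}
  zero_mem' := Or.inl rfl
  add_mem' {a b} ha hb := by
    rcases ha with rfl | ha
    · simpa using hb
    rcases hb with rfl | hb
    · exact Or.inr (by simpa using ha)
    · exact Or.inr (by rw [map_add]; exact add_pos ha hb)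

theorem mem_posCone {ψ : DimVec r →+ ℝ} {a : DimVec r} : a ∈ posCone ψ ↔ a = 0 ∨ 0 < ψ a := Iff.rfl

theorem mem_posCone_neg {ψ : DimVec r →+ ℝ} {a : DimVec r} :
    a ∈ posCone (-ψ) ↔ a = 0 ∨ ψ a < 0 := by
  rw [mem_posCone, AddMonoidHom.neg_apply, neg_pos]

/-- Membership in `M`, imposed in degrees `≤ γ` only. -/
def truncation (M : AddSubmonoid (DimVec r)) (γ : DimVec r) : AddSubmonoid (DimVec r) where
  carrier := {a | a ≤ γ → a ∈ M}
  zero_mem' _ := M.zero_mem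
  add_mem' ha hb hab := M.add_mem (ha (le_self_add.trans hab)) (hb (le_add_self.trans hab))

theorem truncation_mono {M N : AddSubmonoid (DimVec r)} {γ : DimVec r}
    (h : ∀ a ≤ γ, a ∈ M → a ∈ N) : truncation M γ ≤ truncation N γ :=
  fun a ha hle => h a hle (ha hle)

theorem le_truncation (M : AddSubmonoid (DimVec r)) (γ : DimVec r) : M ≤ truncation M γ :=
  fun _ ha _ => ha

variable [Algebra ℚ R]

theorem coeffAt_eq_zero_of_truncation {M : AddSubmonoid (DimVec r)} {γ a : DimVec r}
    {f : MvPowerSeries (Fin r) R} (hf : f ∈ supportedSeries R (truncation M γ)) (ha : a ≤ γ)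
    (haM : a ∉ M) : coeffAt a f = 0 :=
  mem_supportedSeries.1 hf a fun h => haM (h ha)

/-- `f = u w l` is a factorization into series with constant term `1` which, in degrees `≤ γ`, are
supported on `ψ > 0`, `ψ = 0` and `ψ < 0` respectively. -/
structure IsFactorization (ψ : DimVec r →+ ℝ) (γ : DimVec r) (f u w l : MvPowerSeries (Fin r) R) :
    Prop where
  mul_eq : u * w * l = f
  upper_zero : coeffAt 0 u = 1
  middle_zero : coeffAt 0 w = 1
  lower_zero : coeffAt 0 l = 1
  upper_mem : u ∈ supportedSeries R (truncation (posCone ψ) γ)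
  middle_mem : w ∈ supportedSeries R (truncation (AddMonoidHom.mker ψ) γ)
  lower_mem : l ∈ supportedSeries R (truncation (posCone (-ψ)) γ)

namespace IsFactorization

variable {ψ ψ' : DimVec r →+ ℝ} {γ : DimVec r} {f u u' w w' l l' : MvPowerSeries (Fin r) R}

theorem sum_coeffAt_sub_eq_zero (h : IsFactorization ψ γ f u w l)
    (h' : IsFactorization ψ γ f u' w' l') {a : DimVec r}
    (hlt : ∀ b < a, coeffAt b u = coeffAt b u' ∧ coeffAt b w = coeffAt b w' ∧
      coeffAt b l = coeffAt b l') :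
    (coeffAt a u - coeffAt a u') + (coeffAt a w - coeffAt a w') +
      (coeffAt a l - coeffAt a l') = 0 := by
  have huw : ∀ b < a, coeffAt b (u * w) = coeffAt b (u' * w') := fun b hb =>
    coeffAt_mul_congr (fun c hc => (hlt c (hc.trans_lt hb)).1)
      (fun c hc => (hlt c (hc.trans_lt hb)).2.1)
  have huw0 : coeffAt 0 (u' * w') = 1 := by
    rw [coeffAt_zero_mul, h'.upper_zero, h'.middle_zero, one_mul]
  rw [← coeffAt_mul_sub_coeffAt_mul (fun b hb => (hlt b hb).1) (fun b hb => (hlt b hb).2.1)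
      h'.upper_zero h.middle_zero,
    ← coeffAt_mul_sub_coeffAt_mul huw (fun b hb => (hlt b hb).2.2) huw0 h.lower_zero,
    h.mul_eq, h'.mul_eq, sub_self]

theorem coeffAt_eq (h : IsFactorization ψ γ f u w l) (h' : IsFactorization ψ γ f u' w' l')
    {a : DimVec r} (ha : a ≤ γ) :
    coeffAt a u = coeffAt a u' ∧ coeffAt a w = coeffAt a w' ∧ coeffAt a l = coeffAt a l' := by
  induction a using WellFoundedLT.induction with
  | _ a ih =>
    rcases eq_or_ne a 0 with rfl | h0
    · simp [h.upper_zero, h.middle_zero, h.lower_zero, h'.upper_zero, h'.middle_zero, h'.lower_zero]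
    have hsum := h.sum_coeffAt_sub_eq_zero h' fun b hb => ih b hb (hb.le.trans ha)
    have hu : ¬ 0 < ψ a → coeffAt a u = coeffAt a u' := fun hψ => by
      have hn : a ∉ posCone ψ := by rw [mem_posCone]; tauto
      rw [coeffAt_eq_zero_of_truncation h.upper_mem ha hn,
        coeffAt_eq_zero_of_truncation h'.upper_mem ha hn]
    have hw : ¬ ψ a = 0 → coeffAt a w = coeffAt a w' := fun hψ => by
      rw [coeffAt_eq_zero_of_truncation h.middle_mem ha hψ,
        coeffAt_eq_zero_of_truncation h'.middle_mem ha hψ]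
    have hl : ¬ ψ a < 0 → coeffAt a l = coeffAt a l' := fun hψ => by
      have hn : a ∉ posCone (-ψ) := by rw [mem_posCone_neg]; tauto
      rw [coeffAt_eq_zero_of_truncation h.lower_mem ha hn,
        coeffAt_eq_zero_of_truncation h'.lower_mem ha hn]
    rcases lt_trichotomy (ψ a) 0 with hneg | hzero | hpos
    · rw [hu hneg.not_gt, hw hneg.ne, sub_self, sub_self, zero_add, zero_add, sub_eq_zero] at hsum
      exact ⟨hu hneg.not_gt, hw hneg.ne, hsum⟩
    · rw [hu hzero.not_gt, hl hzero.not_lt, sub_self, sub_self, zero_add, add_zero,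
        sub_eq_zero] at hsum
      exact ⟨hu hzero.not_gt, hsum, hl hzero.not_lt⟩
    · rw [hw hpos.ne', hl hpos.not_gt, sub_self, sub_self, add_zero, add_zero, sub_eq_zero] at hsum
      exact ⟨hsum, hw hpos.ne', hl hpos.not_gt⟩

theorem refine_middle (h : IsFactorization ψ γ f u w l) (h' : IsFactorization ψ' γ w u' w' l')
    (hpos : ∀ a ≤ γ, 0 < ψ a → 0 < ψ' a) (hneg : ∀ a ≤ γ, ψ a < 0 → ψ' a < 0) :
    IsFactorization ψ' γ f (u * u') w' (l' * l) where
  mul_eq := by rw [← h.mul_eq, ← h'.mul_eq]; simp only [mul_assoc]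
  upper_zero := by rw [coeffAt_zero_mul, h.upper_zero, h'.upper_zero, one_mul]
  middle_zero := h'.middle_zero
  lower_zero := by rw [coeffAt_zero_mul, h.lower_zero, h'.lower_zero, one_mul]
  upper_mem := mul_mem (supportedSeries_mono
    (truncation_mono fun a ha => Or.imp_right (hpos a ha)) h.upper_mem) h'.upper_mem
  middle_mem := h'.middle_mem
  lower_mem := mul_mem h'.lower_mem (supportedSeries_mono
    (truncation_mono fun a ha => by
      rw [mem_posCone_neg, mem_posCone_neg]
      exact Or.imp_right (hneg a ha)) h.lower_mem)

end IsFactorization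

theorem slopeFactor_mem_supportedSeries {Z : CentralCharge r} {A : DimVec r → R} {J : Set ℝ}
    {M : AddSubmonoid (DimVec r)} (h : ∀ a, a ≠ 0 → Z.slope a ∈ J → a ∈ M) :
    slopeFactor Z A J ∈ supportedSeries R M :=
  slopeFactor_mem fun a ha haJ => mem_supportFamily.2 fun haM => absurd (h a ha haJ) haM

section

variable (Z : CentralCharge r) (A : DimVec r → R) {γ : DimVec r} (hγ : γ ≠ 0)

include hγ

theorem slopeFactor_Ioi_mem :
    slopeFactor Z A (Set.Ioi (Z.slope γ)) ∈ supportedSeries R (posCone (Z.offset γ)) :=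
  slopeFactor_mem_supportedSeries fun _ ha h =>
    mem_posCone.2 (Or.inr ((Z.offset_pos_iff hγ ha).2 h))

theorem slopeFactor_singleton_mem :
    slopeFactor Z A {Z.slope γ} ∈ supportedSeries R (AddMonoidHom.mker (Z.offset γ)) :=
  slopeFactor_mem_supportedSeries fun _ ha h => (Z.offset_eq_zero_iff hγ ha).2 h

theorem slopeFactor_Iio_mem :
    slopeFactor Z A (Set.Iio (Z.slope γ)) ∈ supportedSeries R (posCone (-Z.offset γ)) :=
  slopeFactor_mem_supportedSeries fun _ ha h =>
    mem_posCone_neg.2 (Or.inr ((Z.offset_neg_iff hγ ha).2 h))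

theorem isFactorization_slopeFactor (γ' : DimVec r) :
    IsFactorization (Z.offset γ) γ' (1 + augSeries A) (slopeFactor Z A (Set.Ioi (Z.slope γ)))
      (slopeFactor Z A {Z.slope γ}) (slopeFactor Z A (Set.Iio (Z.slope γ))) where
  mul_eq := slopeFactor_mul_mul Z A (Z.slope γ)
  upper_zero := coeffAt_zero_slopeFactor Z A _
  middle_zero := coeffAt_zero_slopeFactor Z A _
  lower_zero := coeffAt_zero_slopeFactor Z A _
  upper_mem := supportedSeries_mono (le_truncation _ _) (slopeFactor_Ioi_mem Z A hγ)
  middle_mem := supportedSeries_mono (le_truncation _ _) (slopeFactor_singleton_mem Z A hγ)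
  lower_mem := supportedSeries_mono (le_truncation _ _) (slopeFactor_Iio_mem Z A hγ)

end

end Factorization

/-! ### Logarithms -/

section Logarithm

open Finset.HasAntidiagonal (antidiagonal mem_antidiagonal)

variable {r : ℕ} {R : Type*} [Ring R] [Algebra ℚ R]

/-- The coefficient of `log f` at `γ`, for a series `f` with constant term `1`; the powers of
`f - 1` of exponent larger than the degree of `γ` do not contribute. -/
noncomputable def logCoeff (γ : DimVec r) (f : MvPowerSeries (Fin r) R) : R :=
  ∑ k ∈ Finset.range (DimVec.deg γ + 1), ((-1) ^ k / (k + 1 : ℚ)) • coeffAt γ ((f - 1) ^ (k + 1))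

theorem logCoeff_congr {f g : MvPowerSeries (Fin r) R} {γ : DimVec r}
    (h : ∀ a ≤ γ, coeffAt a f = coeffAt a g) : logCoeff γ f = logCoeff γ g := by
  have hpow : ∀ n : ℕ, ∀ a ≤ γ, coeffAt a ((f - 1) ^ n) = coeffAt a ((g - 1) ^ n) := by
    intro n
    induction n with
    | zero => simp
    | succ n ih =>
      intro a ha
      rw [pow_succ, pow_succ]
      exact coeffAt_mul_congr (fun b hb => ih b (hb.trans ha))
        (fun b hb => by rw [map_sub, map_sub, h b (hb.trans ha)])
  exact Finset.sum_congr rfl fun k _ => by rw [hpow _ γ le_rfl]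

theorem logCoeff_eq_zero {M : AddSubmonoid (DimVec r)} {f : MvPowerSeries (Fin r) R}
    (hf : f ∈ supportedSeries R M) {γ : DimVec r} (hγ : γ ∉ M) : logCoeff γ f = 0 :=
  Finset.sum_eq_zero fun k _ => by
    rw [mem_supportedSeries.1 (pow_mem (sub_mem hf (one_mem _)) (k + 1)) γ hγ, smul_zero]

open Classical in
theorem prod_map_slopePart (Z : CentralCharge r) (A : DimVec r → R) {γ : DimVec r} (hγ : γ ≠ 0)
    {α : List (DimVec r)} (hα : α ∈ tuples γ) :
    (α.map (slopePart Z A (Z.slope γ))).prod =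
      if α.Pairwise Z.Equiv then (α.map (stackyDT Z A)).prod else 0 := by
  split_ifs with h <;> rw [Z.pairwise_equiv_iff hγ hα] at h
  · exact congrArg List.prod (List.map_congr_left fun a ha => if_pos (h a ha))
  · push Not at h
    obtain ⟨a, ha, hne⟩ := h
    obtain ⟨β, δ, rfl⟩ := List.append_of_mem ha
    have hzero : slopePart Z A (Z.slope γ) a = 0 := if_neg hne
    simp [hzero]

theorem rationalDT_eq_logCoeff (Z : CentralCharge r) (A : DimVec r → R) {γ : DimVec r}
    (hγ : γ ≠ 0) : rationalDT Z A γ = logCoeff γ (slopeFactor Z A {Z.slope γ}) := by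
  simp only [logCoeff, slopeFactor_singleton, add_sub_cancel_left, augSeries_pow,
    Coll.coeffAt_series, Coll.act, Finset.smul_sum]
  rw [Finset.sum_comm]
  refine Finset.sum_congr rfl fun α hα => ?_
  obtain ⟨h0, hs⟩ := mem_tuples.1 hα
  obtain ⟨n, hn⟩ : ∃ n, α.length = n + 1 := Nat.exists_eq_succ_of_ne_zero fun h => hγ <| by
    rw [← hs, List.length_eq_zero_iff.1 h, List.sum_nil]
  have hlen : α.length ≤ DimVec.deg γ := hs ▸ DimVec.length_le_of_sum_eq α h0
  rw [Finset.sum_eq_single n, prod_map_slopePart Z A hγ hα, lengthColl, if_pos hn, one_smul,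
    logColl, hn]
  · split_ifs <;> simp
  · intro k _ hk
    rw [lengthColl, if_neg (by omega), zero_smul, smul_zero]
  · exact fun h => absurd (Finset.mem_range.2 (by omega)) h

/-- The Euler derivation, multiplying the part of degree `a` by the total degree of `a`. -/
noncomputable def eulerDeriv (f : MvPowerSeries (Fin r) R) : MvPowerSeries (Fin r) R :=
  seriesOf fun a => (DimVec.deg a : ℚ) • coeffAt a f

@[simp] theorem coeffAt_eulerDeriv (f : MvPowerSeries (Fin r) R) (a : DimVec r) :
    coeffAt a (eulerDeriv f) = (DimVec.deg a : ℚ) • coeffAt a f := rfl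

theorem eulerDeriv_mul (f g : MvPowerSeries (Fin r) R) :
    eulerDeriv (f * g) = eulerDeriv f * g + f * eulerDeriv g := by
  refine series_ext fun a => ?_
  simp only [coeffAt_eulerDeriv, map_add, coeffAt_mul, Finset.smul_sum, ← Finset.sum_add_distrib]
  refine Finset.sum_congr rfl fun p hp => ?_
  rw [← mem_antidiagonal.1 hp, map_add, smul_mul_assoc, mul_smul_comm, ← add_smul, Nat.cast_add]

theorem eulerDeriv_sub_one (f : MvPowerSeries (Fin r) R) : eulerDeriv (f - 1) = eulerDeriv f := by
  refine series_ext fun a => ?_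
  rw [coeffAt_eulerDeriv, coeffAt_eulerDeriv, map_sub, coeffAt_one]
  split_ifs with h
  · simp [h]
  · rw [sub_zero]

theorem coeffAt_mul_inverse {x g : MvPowerSeries (Fin r) R} (hx : coeffAt 0 x = 0)
    (hg : g * (1 + x) = 1) {n : ℕ} {γ : DimVec r} (hn : DimVec.deg γ < n)
    (d : MvPowerSeries (Fin r) R) :
    coeffAt γ (d * g) = ∑ k ∈ Finset.range n, (-1 : ℚ) ^ k • coeffAt γ (d * x ^ k) := by
  have hgeom : g = ∑ k ∈ Finset.range n, (-x) ^ k + g * (-x) ^ n := by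
    have h := mul_neg_geom_sum (-x) n
    rw [sub_neg_eq_add] at h
    calc g = g * ((1 + x) * ∑ k ∈ Finset.range n, (-x) ^ k) + g * (-x) ^ n := by
          rw [h]; noncomm_ring
      _ = _ := by rw [← mul_assoc, hg, one_mul]
  have hterm : ∀ k, (-x) ^ k = (-1 : ℚ) ^ k • x ^ k := fun k => by
    rw [← smul_pow, neg_one_smul]
  have htail : coeffAt γ (d * (g * (-x) ^ n)) = 0 := by
    rw [← mul_assoc]
    exact coeffAt_mul_pow_eq_zero (by rw [map_neg, hx, neg_zero]) hn _
  conv_lhs => rw [hgeom, mul_add, map_add, htail, add_zero, Finset.mul_sum, map_sum]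
  simp only [hterm, mul_smul_comm, coeffAt_smul]

/-! ### Traces and wall-crossing -/

/-- The coefficient at `γ` is a trace on the series with coefficients in `C`. -/
def IsTraceAt (C : DimVec r → Submodule ℚ R) [SetLike.GradedMonoid C] (γ : DimVec r) : Prop :=
  ∀ f ∈ gradedSeries C, ∀ g ∈ gradedSeries C, coeffAt γ (f * g) = coeffAt γ (g * f)

variable {C : DimVec r → Submodule ℚ R} [SetLike.GradedMonoid C] {γ : DimVec r}

theorem eulerDeriv_mem {f : MvPowerSeries (Fin r) R} (hf : f ∈ gradedSeries C) :
    eulerDeriv f ∈ gradedSeries C := fun a => (C a).smul_mem _ (hf a)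

namespace IsTraceAt

theorem coeffAt_eulerDeriv_pow_mul (htr : IsTraceAt C γ) {x : MvPowerSeries (Fin r) R}
    (hx : x ∈ gradedSeries C) (k j : ℕ) :
    coeffAt γ (eulerDeriv (x ^ (k + 1)) * x ^ j) =
      (k + 1 : ℚ) • coeffAt γ (eulerDeriv x * x ^ (k + j)) := by
  induction k generalizing j with
  | zero => simp
  | succ k ih =>
    have hcyc : coeffAt γ (x ^ (k + 1) * (eulerDeriv x * x ^ j)) =
        coeffAt γ (eulerDeriv x * x ^ (k + 1 + j)) := by
      rw [htr _ (pow_mem hx _) _ (mul_mem (eulerDeriv_mem hx) (pow_mem hx _)), mul_assoc, ← pow_add,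
        add_comm j]
    rw [pow_succ x (k + 1), eulerDeriv_mul, add_mul, map_add, mul_assoc, ← pow_succ', ih, mul_assoc,
      hcyc, add_right_comm k 1 j, add_assoc k j 1, Nat.cast_succ, add_smul (_ + _), one_smul]

theorem deg_smul_logCoeff (htr : IsTraceAt C γ) {f g : MvPowerSeries (Fin r) R}
    (hf : f ∈ gradedSeries C) (hf0 : coeffAt 0 f = 1) (hg : g * f = 1) :
    (DimVec.deg γ : ℚ) • logCoeff γ f = coeffAt γ (eulerDeriv f * g) := by
  have hx0 : coeffAt 0 (f - 1) = 0 := by rw [map_sub, hf0, coeffAt_zero_one, sub_self]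
  rw [← eulerDeriv_sub_one, coeffAt_mul_inverse hx0 (by rwa [add_sub_cancel]) (Nat.lt_succ_self _),
    logCoeff, Finset.smul_sum]
  refine Finset.sum_congr rfl fun k _ => ?_
  have hpow := htr.coeffAt_eulerDeriv_pow_mul (sub_mem hf (one_mem _)) k 0
  rw [pow_zero, mul_one, coeffAt_eulerDeriv, add_zero] at hpow
  rw [smul_comm, hpow, smul_smul, div_mul_cancel₀ _ (by positivity)]

theorem logCoeff_mul (htr : IsTraceAt C γ) (hγ : γ ≠ 0) {f g : MvPowerSeries (Fin r) R}
    (hf : f ∈ gradedSeries C) (hf0 : coeffAt 0 f = 1) (hg : g ∈ gradedSeries C)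
    (hg0 : coeffAt 0 g = 1) : logCoeff γ (f * g) = logCoeff γ f + logCoeff γ g := by
  obtain ⟨f', hff', hf'f, -⟩ := exists_inverse hf0
  obtain ⟨g', hgg', hg'g, -⟩ := exists_inverse hg0
  have hinv : g' * f' * (f * g) = 1 := by rw [mul_assoc, ← mul_assoc f', hf'f, one_mul, hg'g]
  have hf'C := mem_gradedSeries_of_mul_eq_one hf hf0 hff'
  have hg'C := mem_gradedSeries_of_mul_eq_one hg hg0 hgg'
  have hdeg : (DimVec.deg γ : ℚ) ≠ 0 := by exact_mod_cast (DimVec.deg_pos hγ).ne'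
  refine smul_right_injective R hdeg ?_
  simp only [smul_add]
  rw [htr.deg_smul_logCoeff (mul_mem hf hg) (by rw [coeffAt_zero_mul, hf0, hg0, one_mul]) hinv,
    htr.deg_smul_logCoeff hf hf0 hf'f, htr.deg_smul_logCoeff hg hg0 hg'g, eulerDeriv_mul, add_mul,
    map_add]
  congr 1
  · rw [mul_assoc, ← mul_assoc g, hgg', one_mul]
  · rw [mul_assoc, htr _ hf _ (mul_mem (eulerDeriv_mem hg) (mul_mem hg'C hf'C)), mul_assoc,
      mul_assoc, hf'f, mul_one]

end IsTraceAt

theorem rationalDT_slopePart (htr : IsTraceAt C γ) (hγ : γ ≠ 0) (Z Z' : CentralCharge r)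
    {A : DimVec r → R} (hA : ∀ a, a ≠ 0 → slopePart Z A (Z.slope γ) a ∈ C a) :
    rationalDT Z' (slopePart Z A (Z.slope γ)) γ = rationalDT Z A γ := by
  set B := slopePart Z A (Z.slope γ) with hB
  have hmem : ∀ J, slopeFactor Z' B J ∈ gradedSeries C := fun J =>
    slopeFactor_mem fun a ha _ => stackyDT_mem Z' hA a ha
  have hupper : logCoeff γ (slopeFactor Z' B (Set.Ioi (Z'.slope γ))) = 0 :=
    logCoeff_eq_zero (slopeFactor_Ioi_mem Z' B hγ) (by simp [mem_posCone, hγ])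
  have hlower : logCoeff γ (slopeFactor Z' B (Set.Iio (Z'.slope γ))) = 0 :=
    logCoeff_eq_zero (slopeFactor_Iio_mem Z' B hγ) (by simp [mem_posCone_neg, hγ])
  rw [rationalDT_eq_logCoeff Z A hγ, slopeFactor_singleton, ← hB,
    ← slopeFactor_mul_mul Z' B (Z'.slope γ),
    htr.logCoeff_mul hγ (mul_mem (hmem _) (hmem _)) (by simp) (hmem _) (by simp),
    htr.logCoeff_mul hγ (hmem _) (by simp) (hmem _) (by simp), hupper, hlower, zero_add, add_zero,
    rationalDT_eq_logCoeff Z' B hγ]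

theorem rationalDT_eq_of_offset_signs (htr : IsTraceAt C γ) (hγ : γ ≠ 0) {Z Z' : CentralCharge r}
    {A : DimVec r → R} (hA : ∀ a, a ≠ 0 → slopePart Z A (Z.slope γ) a ∈ C a)
    (hpos : ∀ a ≤ γ, 0 < Z.offset γ a → 0 < Z'.offset γ a)
    (hneg : ∀ a ≤ γ, Z.offset γ a < 0 → Z'.offset γ a < 0) :
    rationalDT Z' A γ = rationalDT Z A γ := by
  have hZ := isFactorization_slopeFactor Z A hγ γ
  rw [slopeFactor_singleton] at hZ
  have hrefined := hZ.refine_middle (isFactorization_slopeFactor Z' _ hγ γ) hpos hneg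
  have hmiddle := fun a (ha : a ≤ γ) =>
    (hrefined.coeffAt_eq (isFactorization_slopeFactor Z' A hγ γ) ha).2.1
  rw [← rationalDT_slopePart htr hγ Z Z' hA, rationalDT_eq_logCoeff Z' _ hγ,
    rationalDT_eq_logCoeff Z' _ hγ]
  exact (logCoeff_congr hmiddle).symm

end Logarithm

/-! ### Weighted paths -/

section ZeroPart

open Finset.HasAntidiagonal (antidiagonal mem_antidiagonal)

variable {r : ℕ} {R : Type*} [Ring R] [Algebra ℚ R]

/-- The dimension vectors on which `ψ` is nonnegative. -/
def nonnegCone (ψ : DimVec r →+ ℝ) : AddSubmonoid (DimVec r) := (AddSubmonoid.nonneg ℝ).comap ψ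

theorem mem_nonnegCone {ψ : DimVec r →+ ℝ} {a : DimVec r} : a ∈ nonnegCone ψ ↔ 0 ≤ ψ a := Iff.rfl

theorem posCone_le_nonnegCone (ψ : DimVec r →+ ℝ) : posCone ψ ≤ nonnegCone ψ := by
  rintro a (rfl | ha)
  · exact (nonnegCone ψ).zero_mem
  · exact ha.le

theorem mker_le_nonnegCone (ψ : DimVec r →+ ℝ) : AddMonoidHom.mker ψ ≤ nonnegCone ψ :=
  fun _ ha => (AddMonoidHom.mem_mker.1 ha).ge

open Classical in
/-- The part of a series supported on `ψ = 0`. -/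
noncomputable def zeroPart (ψ : DimVec r →+ ℝ) :
    MvPowerSeries (Fin r) R →ₗ[ℚ] MvPowerSeries (Fin r) R where
  toFun f := seriesOf fun a => if ψ a = 0 then coeffAt a f else 0
  map_add' f g := series_ext fun a => by
    rw [map_add, coeffAt_seriesOf, coeffAt_seriesOf, coeffAt_seriesOf, map_add, ite_add_zero]
  map_smul' q f := series_ext fun a => by
    rw [RingHom.id_apply, coeffAt_smul, coeffAt_seriesOf, coeffAt_seriesOf, coeffAt_smul,
      smul_ite, smul_zero]

theorem coeffAt_zeroPart {ψ : DimVec r →+ ℝ} {a : DimVec r} (h : ψ a = 0)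
    (f : MvPowerSeries (Fin r) R) : coeffAt a (zeroPart ψ f) = coeffAt a f := if_pos h

theorem coeffAt_zeroPart_of_ne {ψ : DimVec r →+ ℝ} {a : DimVec r} (h : ψ a ≠ 0)
    (f : MvPowerSeries (Fin r) R) : coeffAt a (zeroPart ψ f) = 0 := if_neg h

theorem zeroPart_neg (ψ : DimVec r →+ ℝ) :
    zeroPart (-ψ) = (zeroPart ψ : MvPowerSeries (Fin r) R →ₗ[ℚ] _) :=
  LinearMap.ext fun f => series_ext fun a => by
    simp only [zeroPart, LinearMap.coe_mk, AddHom.coe_mk, AddMonoidHom.neg_apply, neg_eq_zero]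

theorem zeroPart_eq_self {ψ : DimVec r →+ ℝ} {f : MvPowerSeries (Fin r) R}
    (hf : f ∈ supportedSeries R (AddMonoidHom.mker ψ)) : zeroPart ψ f = f :=
  series_ext fun a => by
    by_cases h : ψ a = 0
    · exact coeffAt_zeroPart h f
    · rw [coeffAt_zeroPart_of_ne h, mem_supportedSeries.1 hf a h]

theorem zeroPart_eq_one {ψ : DimVec r →+ ℝ} {f : MvPowerSeries (Fin r) R}
    (hf : f ∈ supportedSeries R (posCone ψ)) (hf0 : coeffAt 0 f = 1) : zeroPart ψ f = 1 := by
  refine series_ext fun a => ?_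
  rcases eq_or_ne a 0 with rfl | ha
  · rw [coeffAt_zeroPart (map_zero ψ), hf0, coeffAt_zero_one]
  rw [coeffAt_one, if_neg ha]
  by_cases h : ψ a = 0
  · rw [coeffAt_zeroPart h, mem_supportedSeries.1 hf a]
    simp [mem_posCone, ha, h]
  · exact coeffAt_zeroPart_of_ne h f

theorem zeroPart_mul {ψ : DimVec r →+ ℝ} {f g : MvPowerSeries (Fin r) R}
    (hf : f ∈ supportedSeries R (nonnegCone ψ)) (hg : g ∈ supportedSeries R (nonnegCone ψ)) :
    zeroPart ψ (f * g) = zeroPart ψ f * zeroPart ψ g := by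
  rw [mem_supportedSeries] at hf hg
  simp only [mem_nonnegCone, not_le] at hf hg
  refine series_ext fun a => ?_
  rw [coeffAt_mul]
  by_cases h : ψ a = 0
  · rw [coeffAt_zeroPart h, coeffAt_mul]
    refine Finset.sum_congr rfl fun p hp => ?_
    have hs : ψ p.1 + ψ p.2 = 0 := by rw [← map_add, mem_antidiagonal.1 hp, h]
    rcases lt_trichotomy (ψ p.1) 0 with h1 | h1 | h1
    · rw [coeffAt_zeroPart_of_ne h1.ne, hf p.1 h1, zero_mul, zero_mul]
    · rw [coeffAt_zeroPart h1, coeffAt_zeroPart (by linarith)]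
    · rw [coeffAt_zeroPart_of_ne h1.ne', hg p.2 (by linarith), mul_zero, zero_mul]
  · rw [coeffAt_zeroPart_of_ne h]
    refine (Finset.sum_eq_zero fun p hp => ?_).symm
    have hs : ψ p.1 + ψ p.2 = ψ a := by rw [← map_add, mem_antidiagonal.1 hp]
    by_cases h1 : ψ p.1 = 0
    · have h2 : ψ p.2 ≠ 0 := fun h2 => h (by rw [← hs, h1, h2, add_zero])
      rw [coeffAt_zeroPart_of_ne h2, mul_zero]
    · rw [coeffAt_zeroPart_of_ne h1, zero_mul]

theorem zeroPart_mul_eq_of_mul_eq {ψ : DimVec r →+ ℝ} {x x' u w l : MvPowerSeries (Fin r) R}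
    (h : x * (u * w * l) = x') (hx : x ∈ supportedSeries R (nonnegCone ψ))
    (hx' : x' ∈ supportedSeries R (nonnegCone (-ψ)))
    (hu : u ∈ supportedSeries R (posCone ψ)) (hu0 : coeffAt 0 u = 1)
    (hw : w ∈ supportedSeries R (AddMonoidHom.mker ψ))
    (hl : l ∈ supportedSeries R (posCone (-ψ))) (hl0 : coeffAt 0 l = 1) :
    zeroPart ψ x * w = zeroPart ψ x' := by
  obtain ⟨k, hlk, -, hk0⟩ := exists_inverse hl0
  have hk : k ∈ supportedSeries R (posCone (-ψ)) := mem_gradedSeries_of_mul_eq_one hl hl0 hlk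
  have hu' := supportedSeries_mono (posCone_le_nonnegCone ψ) hu
  have hw' := supportedSeries_mono (mker_le_nonnegCone ψ) hw
  have hk' := supportedSeries_mono (posCone_le_nonnegCone (-ψ)) hk
  have hxk : x * (u * w) = x' * k := by rw [← h]; simp only [mul_assoc, hlk, mul_one]
  calc zeroPart ψ x * w
      = zeroPart ψ (x * (u * w)) := by
        rw [zeroPart_mul hx (mul_mem hu' hw'), zeroPart_mul hu' hw', zeroPart_eq_one hu hu0,
          one_mul, zeroPart_eq_self hw]
    _ = zeroPart (-ψ) (x' * k) := by rw [hxk, zeroPart_neg]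
    _ = zeroPart ψ x' := by
        rw [zeroPart_mul hx' hk', zeroPart_eq_one hk hk0, mul_one, zeroPart_neg]

end ZeroPart

section WeightedPaths

variable {r : ℕ} {R : Type*} [Ring R] [Algebra ℚ R]

/-- The weight of a lattice point at height `x`. -/
noncomputable def stepWeight (t s : ℚ) (x : ℝ) : ℚ :=
  open Classical in if 0 < x then t - 1 else if x < 0 then t else s + t

theorem stepWeight_of_pos (t s : ℚ) {x : ℝ} (h : 0 < x) : stepWeight t s x = t - 1 := if_pos h

theorem stepWeight_of_neg (t s : ℚ) {x : ℝ} (h : x < 0) : stepWeight t s x = t := by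
  rw [stepWeight, if_neg h.not_gt, if_pos h]

theorem stepWeight_zero (t s : ℚ) : stepWeight t s 0 = s + t := by simp [stepWeight]

/-- The weight of the lattice path with steps `α`: the product of the weights of the endpoints of
its nonempty initial segments, the height of a point being measured by `ψ`. -/
noncomputable def pathColl (ψ : DimVec r →+ ℝ) (t s : ℚ) : Coll r := fun α =>
  ∏ k ∈ Finset.Ico 1 (α.length + 1), stepWeight t s (ψ (α.take k).sum)

theorem pathColl_dropLast (ψ : DimVec r →+ ℝ) (t s : ℚ) {α : List (DimVec r)} (h : α ≠ []) :
    pathColl ψ t s α.dropLast =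
      ∏ k ∈ Finset.Ico 1 α.length, stepWeight t s (ψ (α.take k).sum) := by
  have hl := List.length_pos_iff.2 h
  rw [pathColl, List.length_dropLast, Nat.sub_add_cancel hl]
  refine Finset.prod_congr rfl fun k hk => ?_
  rw [List.dropLast_eq_take, List.take_take,
    min_eq_left (Nat.le_sub_one_of_lt (Finset.mem_Ico.1 hk).2)]

theorem pathColl_eq (ψ : DimVec r →+ ℝ) (t s : ℚ) {α : List (DimVec r)} (h : α ≠ []) :
    pathColl ψ t s α = stepWeight t s (ψ α.sum) * pathColl ψ t s α.dropLast := by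
  rw [pathColl_dropLast ψ t s h, pathColl, Finset.prod_Ico_succ_top (List.length_pos_iff.2 h),
    List.take_length, mul_comm]

/-- The generating series of weighted lattice paths. -/
noncomputable def pathSeries (ψ : DimVec r →+ ℝ) (t s : ℚ) (a : DimVec r → R) :
    MvPowerSeries (Fin r) R := (pathColl ψ t s).series a

section

variable (ψ : DimVec r →+ ℝ) (t s : ℚ) (a : DimVec r → R)

theorem coeffAt_pathSeries_mul {n : DimVec r} (hn : n ≠ 0) :
    coeffAt n (pathSeries ψ t s a * augSeries a) =
      Coll.act (fun α => pathColl ψ t s α.dropLast) a n := by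
  rw [pathSeries, ← series_lengthColl_one, Coll.series_mul_series, Coll.coeffAt_series]
  refine Coll.act_congr (fun α hα => ?_) fun _ _ => rfl
  rw [Coll.conv_lengthColl_one, if_neg]
  rintro rfl
  exact hn (mem_tuples.1 hα).2.symm

theorem coeffAt_pathSeries {n : DimVec r} (hn : n ≠ 0) : coeffAt n (pathSeries ψ t s a) =
    stepWeight t s (ψ n) • coeffAt n (pathSeries ψ t s a * augSeries a) := by
  rw [coeffAt_pathSeries_mul ψ t s a hn, pathSeries, Coll.coeffAt_series, Coll.act, Coll.act,
    Finset.smul_sum]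
  refine Finset.sum_congr rfl fun α hα => ?_
  obtain ⟨-, hs⟩ := mem_tuples.1 hα
  rw [pathColl_eq ψ t s (by rintro rfl; exact hn hs.symm), hs, mul_smul]

theorem coeffAt_pathSeries_mul_one_sub (q : ℚ) (n : DimVec r) :
    coeffAt n (pathSeries ψ t s a * (1 - q • augSeries a)) = coeffAt n 1 +
      (stepWeight t s (ψ n) - q) • coeffAt n (pathSeries ψ t s a * augSeries a) := by
  rw [mul_sub, mul_one, mul_smul_comm, map_sub, coeffAt_smul]
  rcases eq_or_ne n 0 with rfl | hn
  · simp [pathSeries, Coll.act_zero, pathColl]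
  · rw [coeffAt_pathSeries ψ t s a hn, coeffAt_one, if_neg hn, zero_add, sub_smul]

theorem zeroPart_pathSeries_mul_one_sub (q : ℚ) :
    zeroPart ψ (pathSeries ψ t s a * (1 - q • augSeries a)) =
      1 + (s + t - q) • zeroPart ψ (pathSeries ψ t s a * augSeries a) := by
  refine series_ext fun n => ?_
  rw [map_add, coeffAt_smul]
  by_cases h : ψ n = 0
  · rw [coeffAt_zeroPart h, coeffAt_zeroPart h, coeffAt_pathSeries_mul_one_sub, h,
      stepWeight_zero]
  · rw [coeffAt_zeroPart_of_ne h, coeffAt_zeroPart_of_ne h, coeffAt_one,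
      if_neg (by rintro rfl; exact h (map_zero ψ)), smul_zero, add_zero]

theorem pathSeries_mul_mem_supportedSeries {φ : DimVec r →+ ℝ} {q : ℚ}
    (h : ∀ n, φ n < 0 → stepWeight t s (ψ n) = q) :
    pathSeries ψ t s a * (1 - q • augSeries a) ∈ supportedSeries R (nonnegCone φ) :=
  mem_supportedSeries.2 fun n hn => by
    have hneg : φ n < 0 := not_le.1 hn
    rw [coeffAt_pathSeries_mul_one_sub, h n hneg, sub_self, zero_smul, coeffAt_one,
      if_neg (by rintro rfl; simp at hneg), add_zero]

end

theorem eq_sum_of_eq_mul {S : Type*} [Ring S] [Algebra ℚ S] {s : ℚ} {x y : S}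
    (h : x = (1 + s • x) * y) (N : ℕ) :
    x = ∑ k ∈ Finset.range N, s ^ k • y ^ (k + 1) + s ^ N • ((1 + s • x) * y ^ (N + 1)) := by
  induction N with
  | zero => simpa using h
  | succ N ih =>
    have hstep : s • (x * y ^ (N + 1)) = s • ((1 + s • x) * y ^ (N + 2)) := by
      rw [pow_succ' y (N + 1), ← mul_assoc (1 + s • x), ← h]
    conv_lhs => rw [ih]
    rw [Finset.sum_range_succ, add_mul, one_mul, smul_mul_assoc, hstep, smul_add, smul_smul,
      ← pow_succ, add_assoc]

theorem exists_deformation (A : DimVec r → R) (t : ℚ) : ∃ a : DimVec r → R,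
    (1 - t • augSeries a) * (1 + augSeries A) = 1 - (t - 1) • augSeries a := by
  obtain ⟨g, -, hg, -⟩ := exists_inverse (f := 1 + t • augSeries A) (by simp)
  set S := augSeries A with hS
  have hE : augSeries (fun a => coeffAt a (S * g)) = S * g := series_ext fun a => by
    rw [coeffAt_augSeries]
    split_ifs with ha
    · simp [ha, hS]
    · rfl
  have hsub : S * g = S - t • (S * g * S) := by
    have : S * g * (1 + t • S) = S := by rw [mul_assoc, hg, mul_one]
    rw [eq_sub_iff_add_eq]
    simpa only [mul_add, mul_one, mul_smul_comm] using this
  refine ⟨fun a => coeffAt a (S * g), ?_⟩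
  rw [hE, sub_mul, one_mul, mul_add, mul_one, smul_mul_assoc, sub_smul, one_smul]
  nth_rewrite 4 [hsub]
  abel

/-- In `X (1 - t a) (1 + A) = X (1 - (t - 1) a)`, where `X` is the series of weighted paths, the
left factor `X (1 - t a)` is supported on `ψ ≥ 0` and the right-hand side on `ψ ≤ 0`. Comparing the
parts with `ψ = 0` leaves only the middle slope factor of `1 + A`. -/
theorem zeroPart_pathSeries_eq (Z : CentralCharge r) {A a : DimVec r → R} {t : ℚ} (s : ℚ)
    (ha : (1 - t • augSeries a) * (1 + augSeries A) = 1 - (t - 1) • augSeries a)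
    {γ : DimVec r} (hγ : γ ≠ 0) :
    zeroPart (Z.offset γ) (pathSeries (Z.offset γ) t s a * augSeries a) =
      (1 + s • zeroPart (Z.offset γ) (pathSeries (Z.offset γ) t s a * augSeries a)) *
        augSeries (slopePart Z A (Z.slope γ)) := by
  set ψ := Z.offset γ
  set Y := zeroPart ψ (pathSeries ψ t s a * augSeries a) with hY
  have hcompare := zeroPart_mul_eq_of_mul_eq (ψ := ψ)
    (x := pathSeries ψ t s a * (1 - t • augSeries a))
    (x' := pathSeries ψ t s a * (1 - (t - 1) • augSeries a))
    (by rw [slopeFactor_mul_mul Z A (Z.slope γ), mul_assoc, ha])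
    (pathSeries_mul_mem_supportedSeries ψ t s a fun n hn => stepWeight_of_neg t s hn)
    (pathSeries_mul_mem_supportedSeries ψ t s a fun n hn =>
      stepWeight_of_pos t s (by simpa using hn))
    (slopeFactor_Ioi_mem Z A hγ) (coeffAt_zero_slopeFactor Z A _)
    (slopeFactor_singleton_mem Z A hγ) (slopeFactor_Iio_mem Z A hγ)
    (coeffAt_zero_slopeFactor Z A _)
  rw [slopeFactor_singleton, zeroPart_pathSeries_mul_one_sub, zeroPart_pathSeries_mul_one_sub,
    ← hY, add_sub_cancel_right, show s + t - (t - 1) = s + 1 by ring, mul_add, mul_one, add_smul,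
    one_smul, ← add_assoc] at hcompare
  exact (add_left_cancel hcompare).symm

theorem act_pathColl_dropLast (Z : CentralCharge r) {A a : DimVec r → R} {t : ℚ} (s : ℚ)
    (ha : (1 - t • augSeries a) * (1 + augSeries A) = 1 - (t - 1) • augSeries a)
    {γ : DimVec r} (hγ : γ ≠ 0) :
    Coll.act (fun α => pathColl (Z.offset γ) t s α.dropLast) a γ =
      ∑ k ∈ Finset.range (DimVec.deg γ + 1),
        s ^ k • coeffAt γ (augSeries (slopePart Z A (Z.slope γ)) ^ (k + 1)) := by
  rw [← coeffAt_pathSeries_mul _ t s a hγ, ← coeffAt_zeroPart (Z.offset_self γ),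
    eq_sum_of_eq_mul (zeroPart_pathSeries_eq Z s ha hγ) (DimVec.deg γ + 1), map_add, map_sum,
    coeffAt_smul, coeffAt_mul_pow_eq_zero (coeffAt_zero_augSeries _) (by omega), smul_zero,
    add_zero]
  simp only [coeffAt_smul]

end WeightedPaths

section Integration

open Polynomial

theorem exists_antiderivative {ι : Type*} (I : Finset ι) (t : ℚ) (c : ι → ℚ)
    (m : ι → ℕ) : ∃ P : ℚ[X],
      (∀ s, (derivative P).eval s = ∑ i ∈ I, c i * (s + t) ^ m i) ∧
      P.eval 0 - P.eval (-1) =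
        ∑ i ∈ I, c i * ((t ^ (m i + 1) - (t - 1) ^ (m i + 1)) / (m i + 1)) := by
  refine ⟨∑ i ∈ I, C (c i / (m i + 1)) * (X + C t) ^ (m i + 1), fun s => ?_, ?_⟩
  · simp only [derivative_sum, derivative_C_mul, derivative_X_add_C_pow, eval_finsetSum, eval_mul,
      eval_C, eval_pow, eval_add, eval_X, add_tsub_cancel_right, Nat.cast_add, Nat.cast_one]
    refine Finset.sum_congr rfl fun i _ => ?_
    field_simp
  · simp only [eval_finsetSum, ← Finset.sum_sub_distrib, eval_mul, eval_C, eval_pow, eval_add,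
      eval_X, zero_add]
    refine Finset.sum_congr rfl fun i _ => ?_
    ring

/-- Both sides come from integrating the hypothesis over `s ∈ [-1, 0]`. -/
theorem sum_smul_eq_of_forall_eval {V ι κ : Type*} [AddCommGroup V] [Module ℚ V] {I : Finset ι}
    {K : Finset κ} {t u : ℚ} {m : ι → ℕ} {n : κ → ℕ} {v : ι → V} {w : κ → V}
    (h : ∀ s : ℚ, ∑ i ∈ I, (s + t) ^ m i • v i = ∑ k ∈ K, (s + u) ^ n k • w k) :
    ∑ i ∈ I, ((t ^ (m i + 1) - (t - 1) ^ (m i + 1)) / (m i + 1)) • v i =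
      ∑ k ∈ K, ((u ^ (n k + 1) - (u - 1) ^ (n k + 1)) / (n k + 1)) • w k := by
  rw [← sub_eq_zero, ← Module.forall_dual_apply_eq_zero_iff ℚ]
  intro φ
  obtain ⟨P, hP, hPint⟩ := exists_antiderivative I t (fun i => φ (v i)) m
  obtain ⟨Q, hQ, hQint⟩ := exists_antiderivative K u (fun k => φ (w k)) n
  have hderiv : derivative (P - Q) = 0 := Polynomial.funext fun s => by
    have := congrArg φ (h s)
    simp only [map_sum, map_smul, smul_eq_mul, mul_comm _ (φ _)] at this
    rw [derivative_sub, eval_sub, hP, hQ, this, sub_self, eval_zero]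
  obtain ⟨c, hc⟩ : ∃ c, P - Q = C c := ⟨_, eq_C_of_derivative_eq_zero hderiv⟩
  have hconst : (P - Q).eval 0 = (P - Q).eval (-1) := by rw [hc, eval_C, eval_C]
  simp only [eval_sub] at hconst
  simp only [map_sub, map_sum, map_smul, smul_eq_mul, mul_comm _ (φ _)]
  rw [← hPint, ← hQint]
  linarith

end Integration

section GeometricCollection

variable {r : ℕ}

open Classical in
theorem prod_stepWeight (t s : ℚ) {ι : Type*} (I : Finset ι) (x : ι → ℝ) :
    ∏ i ∈ I, stepWeight t s (x i) = t ^ (I.filter fun i => x i < 0).card *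
      (t - 1) ^ (I.filter fun i => 0 < x i).card * (s + t) ^ (I.filter fun i => x i = 0).card := by
  have h : ∀ i ∈ I, stepWeight t s (x i) = (if x i < 0 then t else 1) *
      (if 0 < x i then t - 1 else 1) * (if x i = 0 then s + t else 1) := by
    intro i _
    rcases lt_trichotomy (x i) 0 with h | h | h
    · simp [stepWeight, h, h.not_gt, h.ne]
    · simp [stepWeight, h]
    · simp [stepWeight, h, h.not_gt, h.ne']
  rw [Finset.prod_congr rfl h]
  simp only [Finset.prod_mul_distrib, Finset.prod_ite, Finset.prod_const, one_pow, mul_one]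

theorem CentralCharge.offset_add_left (Z : CentralCharge r) (p q : DimVec r) :
    Z.offset (p + q) p = Z.offset q p := by
  simp only [CentralCharge.offset_apply, Pi.add_apply, Nat.cast_add, mul_add,
    Finset.sum_add_distrib]
  ring

theorem sum_ne_zero_of_ne_nil {α : List (DimVec r)} (h0 : 0 ∉ α) (h : α ≠ []) : α.sum ≠ 0 :=
  fun hs => h <| by simpa [hs] using DimVec.length_le_of_sum_eq α h0

theorem cutCount_congr {P Q : DimVec r → DimVec r → Prop} {γ : DimVec r} {α : List (DimVec r)}
    (hα : α ∈ tuples γ)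
    (h : ∀ p q, p + q = γ → p ≠ 0 → q ≠ 0 → (P p q ↔ Q p q)) : cutCount P α = cutCount Q α := by
  obtain ⟨h0, hs⟩ := mem_tuples.1 hα
  classical
  refine congrArg Finset.card (Finset.filter_congr fun k hk => h _ _ ?_ ?_ ?_)
  · rw [← List.sum_append, List.take_append_drop, hs]
  all_goals
    rw [Finset.mem_Ico] at hk
    refine sum_ne_zero_of_ne_nil (fun h' => h0 ?_) (fun h' => ?_)
  · exact List.mem_of_mem_take h'
  · have := congrArg List.length h'
    rw [List.length_take, List.length_nil] at this
    omega
  · exact List.mem_of_mem_drop h'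
  · have := congrArg List.length h'
    rw [List.length_drop, List.length_nil] at this
    omega

theorem gColl_eq_geometricValue (Z : CentralCharge r) (t : ℚ) {γ : DimVec r}
    {α : List (DimVec r)} (hα : α ∈ tuples γ) : gColl Z t α = geometricValue t
      (cutCount (fun p _ => 0 < Z.offset γ p) α) (cutCount (fun p _ => Z.offset γ p < 0) α)
      (cutCount (fun p _ => Z.offset γ p = 0) α) := by
  unfold gColl
  congr 1
  all_goals
    refine cutCount_congr hα ?_
    rintro p q rfl hp hq
    rw [Z.offset_add_left]
  · exact (Z.offset_pos_iff hq hp).symm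
  · exact (Z.offset_neg_iff hq hp).symm
  · exact (Z.offset_eq_zero_iff hq hp).symm

variable {R : Type*} [Ring R] [Algebra ℚ R]

theorem rationalDT_eq_gColl_act (Z : CentralCharge r) {A a : DimVec r → R} {t : ℚ}
    (ha : (1 - t • augSeries a) * (1 + augSeries A) = 1 - (t - 1) • augSeries a)
    {γ : DimVec r} (hγ : γ ≠ 0) : rationalDT Z A γ = (gColl Z t).act a γ := by
  set ψ := Z.offset γ
  have hpaths (s : ℚ) :
      ∑ α ∈ tuples γ, (s + t) ^ cutCount (fun p _ => ψ p = 0) α •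
        (t ^ cutCount (fun p _ => ψ p < 0) α * (t - 1) ^ cutCount (fun p _ => 0 < ψ p) α) •
          (α.map a).prod =
      ∑ k ∈ Finset.range (DimVec.deg γ + 1),
        (s + 0) ^ k • coeffAt γ (augSeries (slopePart Z A (Z.slope γ)) ^ (k + 1)) := by
    rw [add_zero, ← act_pathColl_dropLast Z s ha hγ, Coll.act]
    refine Finset.sum_congr rfl fun α hα => ?_
    have hne : α ≠ [] := by
      rintro rfl
      exact hγ (mem_tuples.1 hα).2.symm
    rw [pathColl_dropLast _ t s hne, prod_stepWeight, smul_smul, mul_comm]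
    rfl
  rw [rationalDT_eq_logCoeff Z A hγ, slopeFactor_singleton, logCoeff, add_sub_cancel_left,
    Coll.act]
  trans ∑ k ∈ Finset.range (DimVec.deg γ + 1), (((0 : ℚ) ^ (k + 1) - (0 - 1) ^ (k + 1)) /
    (k + 1)) • coeffAt γ (augSeries (slopePart Z A (Z.slope γ)) ^ (k + 1))
  · refine Finset.sum_congr rfl fun k _ => ?_
    congr 2
    ring
  rw [← sum_smul_eq_of_forall_eval hpaths]
  refine Finset.sum_congr rfl fun α hα => ?_
  rw [gColl_eq_geometricValue Z t hα, geometricValue, smul_smul, mul_comm]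

end GeometricCollection

/-! ### Attractor invariants -/

section Genericity

theorem dense_linearForm_ne_zero {𝕜 E : Type*} [NontriviallyNormedField 𝕜] [AddCommGroup E]
    [Module 𝕜 E] [TopologicalSpace E] [ContinuousAdd E] [ContinuousSMul 𝕜 E] {f : E →ₗ[𝕜] 𝕜}
    (hf : f ≠ 0) : Dense {x | f x ≠ 0} := by
  refine interior_eq_empty_iff_dense_compl.1 (Set.not_nonempty_iff_eq_empty.1 fun h => hf ?_)
  exact LinearMap.ker_eq_top.1 (Submodule.eq_top_of_nonempty_interior' _ h)

variable {r : ℕ}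

theorem CentralCharge.offset_ofTheta (θ : Fin r → ℝ) (γ a : DimVec r) : (ofTheta θ).offset γ a =
    Fintype.linearCombination ℝ
      (fun k => (a k : ℝ) * DimVec.deg γ - (γ k : ℝ) * DimVec.deg a) θ := by
  simp only [offset_apply, ofTheta, one_mul, Fintype.linearCombination_apply, smul_eq_mul, mul_sub,
    Finset.sum_sub_distrib, ← mul_assoc, ← Finset.sum_mul, DimVec.deg_apply, Nat.cast_sum]

theorem CentralCharge.continuous_offset_ofTheta (γ a : DimVec r) :
    Continuous fun θ : Fin r → ℝ => (ofTheta θ).offset γ a := by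
  simp only [offset_ofTheta]
  exact LinearMap.continuous_of_finiteDimensional _

theorem CentralCharge.dense_offset_ofTheta_ne_zero {γ a : DimVec r}
    (h : ∃ k, a k * DimVec.deg γ ≠ γ k * DimVec.deg a) :
    Dense {θ : Fin r → ℝ | (ofTheta θ).offset γ a ≠ 0} := by
  simp only [offset_ofTheta]
  refine dense_linearForm_ne_zero fun h0 => ?_
  obtain ⟨k, hk⟩ := h
  have := LinearMap.congr_fun h0 (Pi.single k 1)
  rw [Fintype.linearCombination_apply_single, one_smul, LinearMap.zero_apply, sub_eq_zero] at this
  exact hk (by exact_mod_cast this)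

theorem dense_isGeneric : Dense {θ : Fin r → ℝ | IsGeneric θ} := by
  let I := {p : DimVec r × DimVec r // ∃ k, p.2 k * DimVec.deg p.1 ≠ p.1 k * DimVec.deg p.2}
  have hdense : Dense (⋂ p : I, {θ | (CentralCharge.ofTheta θ).offset p.1.1 p.1.2 ≠ 0}) :=
    dense_iInter_of_isOpen
      (fun p => isOpen_ne_fun (CentralCharge.continuous_offset_ofTheta p.1.1 p.1.2)
        continuous_const)
      fun p => CentralCharge.dense_offset_ofTheta_ne_zero p.2
  refine hdense.mono fun θ hθ a b ha hb hab => ?_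
  have hprop : ∀ k, b k * DimVec.deg a = a k * DimVec.deg b := by
    by_contra! h
    exact Set.mem_iInter.1 hθ ⟨(a, b), h⟩ ((CentralCharge.offset_eq_zero_iff _ ha hb).2 hab.symm)
  refine ⟨DimVec.deg b, DimVec.deg a, DimVec.deg_pos hb, DimVec.deg_pos ha, funext fun k => ?_⟩
  rw [Pi.smul_apply, Pi.smul_apply, smul_eq_mul, smul_eq_mul, mul_comm, ← hprop, mul_comm]

instance genericPerturbations_neBot (ω : (Fin r → ℤ) →ₗ[ℤ] (Fin r → ℤ) →ₗ[ℤ] ℤ) (γ : DimVec r) :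
    (genericPerturbations ω γ).NeBot :=
  mem_closure_iff_nhdsWithin_neBot.1 (dense_isGeneric _)

end Genericity

section SelfStability

variable {r : ℕ} {ω : (Fin r → ℤ) →ₗ[ℤ] (Fin r → ℤ) →ₗ[ℤ] ℤ}

theorem DimVec.toInt_add (a b : DimVec r) : (a + b).toInt = a.toInt + b.toInt := by
  funext k; simp [DimVec.toInt]

theorem DimVec.toInt_eq_sum (a : DimVec r) :
    a.toInt = ∑ k, (a k : ℤ) • (Pi.single k 1 : Fin r → ℤ) := by
  funext i
  simp [DimVec.toInt, Finset.sum_apply, Pi.single_apply]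

variable (ω) in
theorem sum_selfStability_mul (γ a : DimVec r) :
    ∑ k, selfStability ω γ k * a k = (ω a.toInt γ.toInt : ℝ) := by
  rw [a.toInt_eq_sum]
  simp only [map_sum, map_smul, LinearMap.sum_apply, LinearMap.smul_apply, selfStability,
    Int.cast_sum, smul_eq_mul, Int.cast_mul, Int.cast_natCast, mul_comm]

theorem offset_selfStability (hω : ω.IsAlt) (γ a : DimVec r) :
    (CentralCharge.ofTheta (selfStability ω γ)).offset γ a =
      (ω a.toInt γ.toInt : ℝ) * DimVec.deg γ := by
  simp only [CentralCharge.offset_apply, CentralCharge.ofTheta, one_mul, sum_selfStability_mul,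
    hω γ.toInt, Int.cast_zero, zero_mul, sub_zero, DimVec.deg_apply, Nat.cast_sum]

theorem pairing_add_right (hω : ω.IsAlt) (p q : DimVec r) :
    ω p.toInt (p + q).toInt = ω p.toInt q.toInt := by
  rw [DimVec.toInt_add, map_add, hω, zero_add]

theorem gStarColl_eq_gColl (hω : ω.IsAlt) (t : ℚ) {γ : DimVec r} (hγ : γ ≠ 0)
    {α : List (DimVec r)} (hα : α ∈ tuples γ) :
    gStarColl ω t α = gColl (CentralCharge.ofTheta (selfStability ω γ)) t α := by
  have hdeg : (0 : ℝ) < DimVec.deg γ := by exact_mod_cast DimVec.deg_pos hγ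
  have hoffset : ∀ p q, p + q = γ →
      (CentralCharge.ofTheta (selfStability ω γ)).offset γ p =
        (ω p.toInt q.toInt : ℝ) * DimVec.deg γ := by
    rintro p q rfl
    rw [offset_selfStability hω, pairing_add_right hω]
  rw [gColl_eq_geometricValue _ t hα, gStarColl]
  congr 1 <;> refine cutCount_congr hα fun p q hpq _ _ => ?_ <;> rw [hoffset p q hpq]
  · rw [mul_pos_iff_of_pos_right hdeg, Int.cast_pos]
  · rw [← not_le, ← not_le, mul_nonneg_iff_of_pos_right hdeg, Int.cast_nonneg_iff]
  · rw [mul_eq_zero, or_iff_left hdeg.ne', Int.cast_eq_zero]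

end SelfStability

section AttractorInvariants

variable {r : ℕ} {R : Type*} [Ring R] [Algebra ℚ R] {𝒜 : DimVec r → Submodule ℚ R}
  {ω : (Fin r → ℤ) →ₗ[ℤ] (Fin r → ℤ) →ₗ[ℤ] ℤ}

/-- Homogeneous elements commute if their degrees are nonzero and orthogonal for `ω`. -/
def OrthogonalCommute (𝒜 : DimVec r → Submodule ℚ R)
    (ω : (Fin r → ℤ) →ₗ[ℤ] (Fin r → ℤ) →ₗ[ℤ] ℤ) : Prop :=
  ∀ γ γ' : DimVec r, γ ≠ 0 → γ' ≠ 0 → ω γ.toInt γ'.toInt = 0 →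
    ∀ x ∈ 𝒜 γ, ∀ y ∈ 𝒜 γ', x * y = y * x

open Classical in
/-- The homogeneous components of `𝒜` in degrees orthogonal to `γ`. In degree zero they are
replaced by the scalars, as `𝒜 0` need not commute with the other components. -/
noncomputable def orthogonalFamily (𝒜 : DimVec r → Submodule ℚ R)
    (ω : (Fin r → ℤ) →ₗ[ℤ] (Fin r → ℤ) →ₗ[ℤ] ℤ) (γ a : DimVec r) : Submodule ℚ R :=
  if a = 0 then 1 else if ω a.toInt γ.toInt = 0 then 𝒜 a else ⊥

theorem mem_orthogonalFamily {γ a : DimVec r} {x : R} : x ∈ orthogonalFamily 𝒜 ω γ a ↔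
    (a = 0 ∧ ∃ q : ℚ, algebraMap ℚ R q = x) ∨ (a ≠ 0 ∧ ω a.toInt γ.toInt = 0 ∧ x ∈ 𝒜 a) ∨
      x = 0 := by
  unfold orthogonalFamily
  split_ifs with ha h
  · rw [Submodule.mem_one]
    refine ⟨fun h => Or.inl ⟨ha, h⟩, ?_⟩
    rintro (⟨-, h⟩ | ⟨h, -⟩ | rfl)
    exacts [h, absurd ha h, ⟨0, map_zero _⟩]
  · refine ⟨fun hx => Or.inr (Or.inl ⟨ha, h, hx⟩), ?_⟩
    rintro (⟨h, -⟩ | ⟨-, -, h⟩ | rfl)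
    exacts [absurd h ha, h, zero_mem _]
  · rw [Submodule.mem_bot]
    refine ⟨fun h => Or.inr (Or.inr h), ?_⟩
    rintro (⟨h', -⟩ | ⟨-, h', -⟩ | h')
    exacts [absurd h' ha, absurd h' h, h']

instance orthogonalFamily.gradedMonoid [SetLike.GradedMul 𝒜] (γ : DimVec r) :
    SetLike.GradedMonoid (orthogonalFamily 𝒜 ω γ) where
  one_mem := mem_orthogonalFamily.2 (Or.inl ⟨rfl, 1, map_one _⟩)
  mul_mem a b x y hx hy := by
    rcases mem_orthogonalFamily.1 hx with ⟨rfl, q, rfl⟩ | ⟨ha, hω, hx⟩ | rfl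
    · rw [zero_add, ← Algebra.smul_def]
      exact Submodule.smul_mem _ q hy
    · rcases mem_orthogonalFamily.1 hy with ⟨rfl, q, rfl⟩ | ⟨-, hω', hy⟩ | rfl
      · rw [add_zero, ← Algebra.commutes, ← Algebra.smul_def]
        exact Submodule.smul_mem _ q (mem_orthogonalFamily.2 (Or.inr (Or.inl ⟨ha, hω, hx⟩)))
      · refine mem_orthogonalFamily.2 (Or.inr (Or.inl ⟨fun h => ha (add_eq_zero.1 h).1, ?_,
          SetLike.mul_mem_graded hx hy⟩))
        rw [DimVec.toInt_add, map_add, LinearMap.add_apply, hω, hω', add_zero]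
      · rw [mul_zero]
        exact zero_mem _
    · rw [zero_mul]
      exact zero_mem _

theorem isTraceAt_orthogonalFamily [SetLike.GradedMul 𝒜] (hω : ω.IsAlt)
    (hcomm : OrthogonalCommute 𝒜 ω) (γ : DimVec r) :
    IsTraceAt (orthogonalFamily 𝒜 ω γ) γ := fun f hf g hg => by
  rw [coeffAt_mul, coeffAt_mul]
  conv_rhs => rw [← Finset.HasAntidiagonal.map_swap_antidiagonal, Finset.sum_map]
  refine Finset.sum_congr rfl fun ⟨b, a⟩ hp => ?_
  obtain rfl : b + a = γ := Finset.HasAntidiagonal.mem_antidiagonal.1 hp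
  change coeffAt b f * coeffAt a g = coeffAt a g * coeffAt b f
  rcases mem_orthogonalFamily.1 (hf b) with ⟨-, q, hq⟩ | ⟨hb, hω', hfb⟩ | h
  · rw [← hq, Algebra.commutes]
  · rcases mem_orthogonalFamily.1 (hg a) with ⟨-, q, hq⟩ | ⟨ha, -, hga⟩ | h
    · rw [← hq, Algebra.commutes]
    · rw [pairing_add_right hω] at hω'
      exact hcomm b a hb ha hω' _ hfb _ hga
    · rw [h, mul_zero, zero_mul]
  · rw [h, mul_zero, zero_mul]

open CentralCharge in
theorem eventually_offset_signs (θ : Fin r → ℝ) (γ : DimVec r) : ∀ᶠ θ' in 𝓝 θ, ∀ a ≤ γ,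
    (0 < (ofTheta θ).offset γ a → 0 < (ofTheta θ').offset γ a) ∧
      ((ofTheta θ).offset γ a < 0 → (ofTheta θ').offset γ a < 0) := by
  refine (eventually_all_finite (Set.finite_Iic γ)).2 fun a _ => ?_
  have hlim := (continuous_offset_ofTheta γ a).tendsto θ
  refine Eventually.and (eventually_imp_distrib_left.2 fun h => ?_)
    (eventually_imp_distrib_left.2 fun h => ?_)
  exacts [hlim.eventually_const_lt h, hlim.eventually_lt_const h]

variable [SetLike.GradedMonoid 𝒜]

theorem eventually_rationalDT_eq (hω : ω.IsAlt) (hcomm : OrthogonalCommute 𝒜 ω)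
    {A : DimVec r → R} (hA : ∀ γ, γ ≠ 0 → A γ ∈ 𝒜 γ) {γ : DimVec r} (hγ : γ ≠ 0) :
    ∀ᶠ θ' in 𝓝 (selfStability ω γ), rationalDT (CentralCharge.ofTheta θ') A γ =
      rationalDT (CentralCharge.ofTheta (selfStability ω γ)) A γ := by
  filter_upwards [eventually_offset_signs (selfStability ω γ) γ] with θ' h
  refine rationalDT_eq_of_offset_signs (isTraceAt_orthogonalFamily hω hcomm γ) hγ (fun a ha => ?_)
    (fun a ha => (h a ha).1) (fun a ha => (h a ha).2)
  unfold slopePart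
  split_ifs with hslope
  · have hoffset := (CentralCharge.offset_eq_zero_iff _ hγ ha).2 hslope
    rw [offset_selfStability hω, mul_eq_zero,
      or_iff_left (Nat.cast_ne_zero.2 (DimVec.deg_pos hγ).ne'), Int.cast_eq_zero] at hoffset
    exact mem_orthogonalFamily.2 (Or.inr (Or.inl ⟨ha, hoffset, stackyDT_mem _ hA a ha⟩))
  · exact zero_mem _

theorem attractorDT_eq (hω : ω.IsAlt) (hcomm : OrthogonalCommute 𝒜 ω)
    {A : DimVec r → R} (hA : ∀ γ, γ ≠ 0 → A γ ∈ 𝒜 γ) {γ : DimVec r} (hγ : γ ≠ 0) :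
    attractorDT ω A γ = rationalDT (CentralCharge.ofTheta (selfStability ω γ)) A γ := by
  have h := (eventually_rationalDT_eq hω hcomm hA hγ).filter_mono
    (nhdsWithin_le_nhds : genericPerturbations ω γ ≤ _)
  have hspec := Classical.epsilon_spec (p := fun x : R => ∀ᶠ θ' in genericPerturbations ω γ,
    rationalDT (CentralCharge.ofTheta θ') A γ = x) ⟨_, h⟩
  obtain ⟨θ', h₁, h₂⟩ := (hspec.and h).exists
  exact h₁.symm.trans h₂

theorem attractorDT_eq_gStarColl_act (hω : ω.IsAlt) (hcomm : OrthogonalCommute 𝒜 ω)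
    {A a : DimVec r → R} (hA : ∀ γ, γ ≠ 0 → A γ ∈ 𝒜 γ) {t : ℚ}
    (ha : (1 - t • augSeries a) * (1 + augSeries A) = 1 - (t - 1) • augSeries a)
    {γ : DimVec r} (hγ : γ ≠ 0) : attractorDT ω A γ = (gStarColl ω t).act a γ := by
  rw [attractorDT_eq hω hcomm hA hγ, rationalDT_eq_gColl_act _ ha hγ]
  exact Coll.act_congr (fun α hα => (gStarColl_eq_gColl hω t hγ hα).symm) fun _ _ => rfl

end AttractorInvariants

/-! ### Inverting collections with plane trees -/

section Forests

theorem cons_pair_injective (Y : Type*) :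
    Function.Injective fun p : Y × List Y => p.1 :: p.2 :=
  fun p q h => by simpa [Prod.ext_iff] using h

/-- The lists obtained by choosing an element of `s x` for each entry `x` of a list. -/
noncomputable def listChoices {X Y : Type*} (s : X → Finset Y) : List X → Finset (List Y)
  | [] => {[]}
  | x :: l => (s x ×ˢ listChoices s l).map ⟨fun p => p.1 :: p.2, cons_pair_injective Y⟩

theorem mem_listChoices {X Y : Type*} {s : X → Finset Y} :
    ∀ {l : List X} {c : List Y}, c ∈ listChoices s l ↔ List.Forall₂ (fun x y => y ∈ s x) l c
  | [], c => by simp [listChoices]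
  | x :: l, c => by
    simp only [listChoices, Finset.mem_map, List.forall₂_cons_left_iff, Finset.mem_product,
      Prod.exists, Function.Embedding.coeFn_mk, mem_listChoices, and_assoc, eq_comm (b := c)]

theorem prod_map_sum {X Y R : Type*} [Semiring R] (s : X → Finset Y) (f : Y → R) (l : List X) :
    (l.map fun x => ∑ y ∈ s x, f y).prod = ∑ c ∈ listChoices s l, (c.map f).prod := by
  induction l with
  | nil => simp [listChoices]
  | cons x l ih =>
    rw [List.map_cons, List.prod_cons, ih, listChoices, Finset.sum_map, Finset.sum_mul_sum,
      Finset.sum_product]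
    simp

namespace PlaneTree

section Reduced

variable {X : Type*}

theorem isReduced_leaf (x : X) : (leaf x).IsReduced := by
  simp [IsReduced, vertices]

theorem isReduced_node {c : List (PlaneTree X)} :
    (node c).IsReduced ↔ 2 ≤ c.length ∧ ∀ u ∈ c, u.IsReduced := by
  simp only [IsReduced, vertices, List.forall_mem_cons, List.forall_mem_flatMap]

theorem length_le_length_flatMap_leaves {c : List (PlaneTree X)} (h : ∀ u ∈ c, u.IsReduced) :
    c.length ≤ (c.flatMap leaves).length := by
  rw [List.length_flatMap, ← List.length_map (f := fun u => u.leaves.length)]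
  refine List.length_le_sum_of_one_le _ fun n hn => ?_
  obtain ⟨u, hu, rfl⟩ := List.mem_map.1 hn
  exact List.length_pos_iff.2 (leaves_ne_nil u (h u hu))

theorem reducedOn_singleton (x : X) : reducedOn [x] = {leaf x} := by
  ext T
  rw [mem_reducedOn, Finset.mem_singleton]
  refine ⟨fun ⟨hl, hred⟩ => ?_, fun h => h ▸ ⟨by rw [leaves], isReduced_leaf x⟩⟩
  cases T with
  | leaf y => rw [leaves, List.singleton_inj] at hl; rw [hl]
  | node c =>
    obtain ⟨hc, hcred⟩ := isReduced_node.1 hred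
    have hlen := hc.trans (length_le_length_flatMap_leaves hcred)
    rw [← leaves, hl] at hlen
    exact absurd hlen (by simp)

end Reduced

variable {r : ℕ}

section InverseWeight

/-- The contribution `(-1)^|V(T)| ∏_{v ∈ V(T)} h(α|_{ch v})` of a tree `T` to the inverse of the
collection `h`. -/
def inverseWeight (h : Coll r) (T : PlaneTree (DimVec r)) : ℚ :=
  (-1) ^ T.vertices.length * (T.vertices.map fun c => h (childTuple c)).prod

theorem inverseWeight_leaf (h : Coll r) (x : DimVec r) : inverseWeight h (leaf x) = 1 := by
  simp [inverseWeight, vertices]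

theorem prod_inverseWeight (h : Coll r) (c : List (PlaneTree (DimVec r))) :
    (c.map (inverseWeight h)).prod = (-1) ^ (c.flatMap vertices).length *
      ((c.flatMap vertices).map fun d => h (childTuple d)).prod := by
  induction c with
  | nil => simp
  | cons u c ih =>
    rw [List.map_cons, List.prod_cons, ih, inverseWeight, List.flatMap_cons, List.length_append,
      List.map_append, List.prod_append, pow_add]
    ring

theorem inverseWeight_node (h : Coll r) (c : List (PlaneTree (DimVec r))) :
    inverseWeight h (node c) = -(h (childTuple c) * (c.map (inverseWeight h)).prod) := by
  rw [prod_inverseWeight, inverseWeight, vertices, List.length_cons, List.map_cons, List.prod_cons,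
    pow_succ]
  ring

theorem contribution_node (g h : Coll r) (c : List (PlaneTree (DimVec r))) :
    contribution g h (node c) =
      (g (childTuple c) - h (childTuple c)) * (c.map (inverseWeight h)).prod := by
  rw [prod_inverseWeight, contribution, vertices, List.length_cons, List.tail_cons,
    Nat.add_sub_cancel]
  ring

end InverseWeight

section TreesOfSum

/-- The reduced plane trees whose labels are nonzero and have sum `γ`. -/
noncomputable def treesOfSum (γ : DimVec r) : Finset (PlaneTree (DimVec r)) :=
  open Classical in (tuples γ).biUnion reducedOn

theorem mem_treesOfSum {γ : DimVec r} {T : PlaneTree (DimVec r)} :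
    T ∈ treesOfSum γ ↔ T.leaves ∈ tuples γ ∧ T.IsReduced := by
  simp only [treesOfSum, Finset.mem_biUnion, mem_reducedOn]
  exact ⟨fun ⟨_, hα, hl, h⟩ => ⟨hl ▸ hα, h⟩, fun ⟨hα, h⟩ => ⟨_, hα, rfl, h⟩⟩

theorem sum_biUnion_reducedOn {M : Type*} [AddCommMonoid M] [DecidableEq (PlaneTree (DimVec r))]
    (s : Finset (List (DimVec r))) (φ : PlaneTree (DimVec r) → M) :
    ∑ T ∈ s.biUnion reducedOn, φ T = ∑ α ∈ s, ∑ T ∈ reducedOn α, φ T :=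
  Finset.sum_biUnion fun _ _ _ _ hne => Finset.disjoint_left.2 fun _ hT hT' =>
    hne ((mem_reducedOn.1 hT).1.symm.trans (mem_reducedOn.1 hT').1)

theorem sum_flatMap_leaves (c : List (PlaneTree (DimVec r))) :
    (c.flatMap leaves).sum = (childTuple c).sum := by
  induction c with
  | nil => rfl
  | cons u c ih => simp [childTuple, ih]

theorem mem_listChoices_treesOfSum {β : List (DimVec r)} {c : List (PlaneTree (DimVec r))} :
    c ∈ listChoices treesOfSum β ↔ β = childTuple c ∧ ∀ u ∈ c, 0 ∉ u.leaves ∧ u.IsReduced := by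
  rw [mem_listChoices]
  induction c generalizing β with
  | nil => simp [childTuple]
  | cons u c ih =>
    rw [List.forall₂_cons_right_iff, List.forall_mem_cons]
    constructor
    · rintro ⟨b, β, hb, hβ, rfl⟩
      obtain ⟨rfl, hc⟩ := ih.1 hβ
      obtain ⟨hu, hured⟩ := mem_treesOfSum.1 hb
      obtain ⟨h0, rfl⟩ := mem_tuples.1 hu
      exact ⟨rfl, ⟨h0, hured⟩, hc⟩
    · rintro ⟨rfl, ⟨h0, hured⟩, hc⟩
      exact ⟨_, _, mem_treesOfSum.2 ⟨mem_tuples.2 ⟨h0, rfl⟩, hured⟩, ih.2 ⟨rfl, hc⟩, rfl⟩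

/-- The lists of at least two reduced plane trees whose labels are nonzero and have sum `γ`. -/
noncomputable def forestsOfSum (γ : DimVec r) : Finset (List (PlaneTree (DimVec r))) :=
  open Classical in ((tuples γ).filter fun β => 2 ≤ β.length).biUnion (listChoices treesOfSum)

theorem mem_forestsOfSum {γ : DimVec r} {c : List (PlaneTree (DimVec r))} :
    c ∈ forestsOfSum γ ↔
      2 ≤ c.length ∧ c.flatMap leaves ∈ tuples γ ∧ ∀ u ∈ c, u.IsReduced := by
  simp only [forestsOfSum, Finset.mem_biUnion, Finset.mem_filter, mem_listChoices_treesOfSum,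
    mem_tuples, List.mem_flatMap, sum_flatMap_leaves]
  constructor
  · rintro ⟨_, ⟨⟨-, hs⟩, hlen⟩, rfl, hc⟩
    rw [childTuple, List.length_map] at hlen
    exact ⟨hlen, ⟨fun ⟨u, hu, h⟩ => (hc u hu).1 h, hs⟩, fun u hu => (hc u hu).2⟩
  · rintro ⟨hlen, ⟨h0, hs⟩, hc⟩
    refine ⟨_, ⟨⟨fun h => ?_, hs⟩, by rwa [childTuple, List.length_map]⟩, rfl,
      fun u hu => ⟨fun h => h0 ⟨u, hu, h⟩, hc u hu⟩⟩
    obtain ⟨u, hu, hus⟩ := List.mem_map.1 h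
    exact sum_ne_zero_of_ne_nil (fun h' => h0 ⟨u, hu, h'⟩) (leaves_ne_nil u (hc u hu)) hus

theorem sum_reducedOn_eq_sum_forestsOfSum {M : Type*} [AddCommMonoid M] (γ : DimVec r)
    (φ : PlaneTree (DimVec r) → M) :
    ∑ α ∈ (tuples γ).filter (fun α => 2 ≤ α.length), ∑ T ∈ reducedOn α, φ T =
      ∑ c ∈ forestsOfSum γ, φ (node c) := by
  classical
  rw [← sum_biUnion_reducedOn, ← Finset.sum_image (g := node) fun c _ d _ => node.inj]
  refine Finset.sum_congr (Finset.ext fun T => ?_) fun _ _ => rfl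
  simp only [Finset.mem_biUnion, Finset.mem_filter, mem_reducedOn, Finset.mem_image,
    mem_forestsOfSum]
  constructor
  · rintro ⟨_, ⟨hα, hlen⟩, rfl, hred⟩
    cases T with
    | leaf x => exact absurd hlen (by simp [leaves])
    | node c =>
      obtain ⟨hc, hcred⟩ := isReduced_node.1 hred
      exact ⟨c, ⟨hc, by rwa [leaves] at hα, hcred⟩, rfl⟩
  · rintro ⟨c, ⟨hc, hα, hcred⟩, rfl⟩
    refine ⟨_, ⟨?_, ?_⟩, rfl, isReduced_node.2 ⟨hc, hcred⟩⟩ <;> rw [leaves]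
    exacts [hα, hc.trans (length_le_length_flatMap_leaves hcred)]

end TreesOfSum

end PlaneTree

end Forests

section InverseCollection

open PlaneTree

variable {r : ℕ} {R : Type*} [Ring R] [Algebra ℚ R]

namespace Coll

theorem act_eq_add {F : Coll r} {γ : DimVec r} (hγ : γ ≠ 0) (hF : F [γ] = 1) (H : DimVec r → R) :
    F.act H γ =
      H γ + ∑ α ∈ (tuples γ).filter (fun α => 2 ≤ α.length), F α • (α.map H).prod := by
  rw [Coll.act, ← Finset.sum_filter_add_sum_filter_not (tuples γ) (fun α => 2 ≤ α.length),
    tuples_filter_short hγ, Finset.sum_singleton, hF, one_smul, List.map_singleton,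
    List.prod_singleton, add_comm]

theorem act_injective {F : Coll r} (hF : ∀ γ, γ ≠ 0 → F [γ] = 1) {H K : DimVec r → R}
    (h : ∀ γ, γ ≠ 0 → F.act H γ = F.act K γ) (γ : DimVec r) (hγ : γ ≠ 0) : H γ = K γ := by
  induction hn : DimVec.deg γ using Nat.strong_induction_on generalizing γ with
  | _ n ih =>
    have hlong : ∑ α ∈ (tuples γ).filter (fun α => 2 ≤ α.length), F α • (α.map H).prod =
        ∑ α ∈ (tuples γ).filter (fun α => 2 ≤ α.length), F α • (α.map K).prod := by
      refine Finset.sum_congr rfl fun α hα => ?_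
      obtain ⟨hα, hlen⟩ := Finset.mem_filter.1 hα
      rw [List.map_congr_left fun b hb => ih _ (hn ▸ sum_lt_of_mem_tuples hα hlen hb) b
        (ne_of_mem_of_not_mem hb (mem_tuples.1 hα).1) rfl]
    have := h γ hγ
    rw [act_eq_add hγ (hF γ hγ), act_eq_add hγ (hF γ hγ), hlong] at this
    exact add_right_cancel this

/-- The inverse of a collection `h` with `h [γ] = 1` for composition of collections, as a sum over
plane trees. -/
noncomputable def inverse (h : Coll r) : Coll r := fun α => ∑ T ∈ reducedOn α, inverseWeight h T

/-- The summand of `T` in the action of the inverse of `h` on `H`. -/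
def inverseTerm (h : Coll r) (H : DimVec r → R) (T : PlaneTree (DimVec r)) : R :=
  inverseWeight h T • (T.leaves.map H).prod

theorem prod_inverseTerm (h : Coll r) (H : DimVec r → R) (c : List (PlaneTree (DimVec r))) :
    (c.map (h.inverseTerm H)).prod =
      (c.map (inverseWeight h)).prod • ((node c).leaves.map H).prod := by
  rw [leaves]
  induction c with
  | nil => simp
  | cons u c ih =>
    rw [List.map_cons, List.prod_cons, ih, inverseTerm, List.map_cons, List.prod_cons,
      List.flatMap_cons, List.map_append, List.prod_append, smul_mul_smul_comm]

theorem sum_reducedOn_smul (w : PlaneTree (DimVec r) → ℚ) (H : DimVec r → R)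
    (α : List (DimVec r)) : (∑ T ∈ reducedOn α, w T) • (α.map H).prod =
      ∑ T ∈ reducedOn α, w T • (T.leaves.map H).prod := by
  rw [Finset.sum_smul]
  exact Finset.sum_congr rfl fun T hT => by rw [(mem_reducedOn.1 hT).1]

theorem inverse_act_eq_sum (h : Coll r) (H : DimVec r → R) (γ : DimVec r) :
    h.inverse.act H γ = ∑ T ∈ treesOfSum γ, h.inverseTerm H T := by
  classical
  rw [treesOfSum, sum_biUnion_reducedOn]
  exact Finset.sum_congr rfl fun α _ => sum_reducedOn_smul _ H α

theorem inverse_act (h : Coll r) (H : DimVec r → R) {γ : DimVec r} (hγ : γ ≠ 0) :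
    h.inverse.act H γ =
      H γ - ∑ c ∈ forestsOfSum γ, h (childTuple c) • (c.map (h.inverseTerm H)).prod := by
  have hone : h.inverse [γ] = 1 := by
    rw [inverse, reducedOn_singleton, Finset.sum_singleton, inverseWeight_leaf]
  rw [act_eq_add hγ hone, sub_eq_add_neg, ← Finset.sum_neg_distrib]
  simp only [inverse, sum_reducedOn_smul, sum_reducedOn_eq_sum_forestsOfSum]
  congr 1
  refine Finset.sum_congr rfl fun c _ => ?_
  rw [inverseWeight_node, prod_inverseTerm, neg_smul, mul_smul]

theorem act_inverse_act {f : Coll r} (h : Coll r) (H : DimVec r → R) {γ : DimVec r} (hγ : γ ≠ 0)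
    (hf : f [γ] = 1) : f.act (h.inverse.act H) γ = h.inverse.act H γ +
      ∑ c ∈ forestsOfSum γ, f (childTuple c) • (c.map (h.inverseTerm H)).prod := by
  classical
  rw [act_eq_add hγ hf, forestsOfSum, Finset.sum_biUnion]
  · congr 1
    refine Finset.sum_congr rfl fun β _ => ?_
    rw [funext (h.inverse_act_eq_sum H), prod_map_sum, Finset.smul_sum]
    exact Finset.sum_congr rfl fun c hc => by rw [(mem_listChoices_treesOfSum.1 hc).1]
  · exact fun β _ β' _ hne => Finset.disjoint_left.2 fun c hc hc' => hne <|
      (mem_listChoices_treesOfSum.1 hc).1.trans (mem_listChoices_treesOfSum.1 hc').1.symm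

theorem act_inverse_act_self {h : Coll r} (H : DimVec r → R) {γ : DimVec r} (hγ : γ ≠ 0)
    (hone : h [γ] = 1) : h.act (h.inverse.act H) γ = H γ := by
  rw [act_inverse_act h H hγ hone, inverse_act h H hγ, sub_add_cancel]

end Coll

theorem geometricValue_zero (t : ℚ) : geometricValue t 0 0 0 = 1 := by
  simp [geometricValue]

theorem cutCount_singleton (P : DimVec r → DimVec r → Prop) (a : DimVec r) :
    cutCount P [a] = 0 := by
  simp [cutCount]

theorem gColl_singleton (Z : CentralCharge r) (t : ℚ) (a : DimVec r) : gColl Z t [a] = 1 := by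
  simp only [gColl, cutCount_singleton, geometricValue_zero]

variable (ω : (Fin r → ℤ) →ₗ[ℤ] (Fin r → ℤ) →ₗ[ℤ] ℤ)

theorem gStarColl_singleton (t : ℚ) (a : DimVec r) : gStarColl ω t [a] = 1 := by
  simp only [gStarColl, cutCount_singleton, geometricValue_zero]

theorem treeColl_act (Z : CentralCharge r) (t : ℚ) (H : DimVec r → R) {γ : DimVec r}
    (hγ : γ ≠ 0) :
    (treeColl ω Z t).act H γ = (gColl Z t).act ((gStarColl ω t).inverse.act H) γ := by
  have hlong : ∀ α ∈ (tuples γ).filter (fun α => 2 ≤ α.length), treeColl ω Z t α =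
      ∑ T ∈ reducedOn α, T.contribution (gColl Z t) (gStarColl ω t) := fun α hα =>
    if_neg (Nat.lt_of_succ_le (Finset.mem_filter.1 hα).2).ne'
  rw [Coll.act_eq_add hγ (if_pos rfl), Coll.act_inverse_act _ H hγ (gColl_singleton Z t γ),
    Coll.inverse_act _ H hγ, sub_add_eq_add_sub, add_sub_assoc, ← Finset.sum_sub_distrib,
    Finset.sum_congr rfl fun α hα => by rw [hlong α hα, Coll.sum_reducedOn_smul],
    sum_reducedOn_eq_sum_forestsOfSum]
  congr 1
  refine Finset.sum_congr rfl fun c _ => ?_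
  rw [contribution_node, Coll.prod_inverseTerm, mul_smul, sub_smul]

end InverseCollection

/-! ### The attractor tree formula -/

theorem mainTheorem1_general {r : ℕ} {R : Type*} [Ring R] [Algebra ℚ R]
    {𝒜 : (Fin r → ℕ) → Submodule ℚ R} [SetLike.GradedMonoid 𝒜]
    {ω : (Fin r → ℤ) →ₗ[ℤ] (Fin r → ℤ) →ₗ[ℤ] ℤ} (hω : ω.IsAlt) (hcomm : OrthogonalCommute 𝒜 ω)
    {A : DimVec r → R} (hA : ∀ γ : DimVec r, γ ≠ 0 → A γ ∈ 𝒜 γ) :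
    (∀ γ : DimVec r, γ ≠ 0 → ∀ᶠ θ' in 𝓝 (selfStability ω γ),
      rationalDT (CentralCharge.ofTheta θ') A γ = attractorDT ω A γ) ∧
    ∀ (Z : CentralCharge r) (t : ℚ) (γ : DimVec r), γ ≠ 0 →
      rationalDT Z A γ = (treeColl ω Z t).act (attractorDT ω A) γ := by
  refine ⟨fun γ hγ => ?_, fun Z t γ hγ => ?_⟩
  · rw [attractorDT_eq hω hcomm hA hγ]
    exact eventually_rationalDT_eq hω hcomm hA hγ
  · obtain ⟨a, ha⟩ := exists_deformation A t
    have hinv : ∀ β, β ≠ 0 → a β = (gStarColl ω t).inverse.act (attractorDT ω A) β :=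
      Coll.act_injective (fun β _ => gStarColl_singleton ω t β) fun β hβ => by
        rw [Coll.act_inverse_act_self _ hβ (gStarColl_singleton ω t β),
          attractorDT_eq_gStarColl_act hω hcomm hA ha hβ]
    rw [rationalDT_eq_gColl_act Z ha hγ, treeColl_act ω Z t _ hγ]
    exact Coll.act_congr (fun _ _ => rfl) hinv

theorem mainTheorem1 {r : ℕ} {R : Type*} [Ring R] [Algebra ℚ R]
    (𝒜 : (Fin r → ℕ) → Submodule ℚ R) [GradedAlgebra 𝒜]
    (ω : (Fin r → ℤ) →ₗ[ℤ] (Fin r → ℤ) →ₗ[ℤ] ℤ)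
    (hskew : ∀ x y : Fin r → ℤ, ω x y = -ω y x)
    (hcomm : ∀ γ γ' : DimVec r, γ ≠ 0 → γ' ≠ 0 → ω γ.toInt γ'.toInt = 0 →
      ∀ x ∈ 𝒜 γ, ∀ y ∈ 𝒜 γ', x * y = y * x)
    (A : DimVec r → R) (hA : ∀ γ : DimVec r, γ ≠ 0 → A γ ∈ 𝒜 γ) :
    (∀ γ : DimVec r, γ ≠ 0 → ∀ᶠ θ' in genericPerturbations ω γ,
      rationalDT (CentralCharge.ofTheta θ') A γ = attractorDT ω A γ) ∧
    ∀ (Z : CentralCharge r) (t : ℚ) (γ : DimVec r), γ ≠ 0 →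
      rationalDT Z A γ = (treeColl ω Z t).act (attractorDT ω A) γ := by
  obtain ⟨hattractor, htree⟩ := mainTheorem1_general (fun x => by linarith [hskew x x]) hcomm hA
  exact ⟨fun γ hγ => (hattractor γ hγ).filter_mono nhdsWithin_le_nhds, htree⟩
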